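/- Let $(a,q)_n=\prod_{k=0}^{n-1}(1-aq^k)$, $\eta_k=q^{k/24}\prod_{n\ge 1}(1-q^{kn})$, and consider the hauptmoduln $$j_3=\frac{\eta_1^{12}}{\eta_3^{12}},\qquad j_6=\frac{\eta_2^3\eta_3^9}{\eta_1^3\eta_6^9},\qquad j_{12}=\frac{\eta_4^4\eta_6^2}{\eta_2^2\eta_{12}^4},$$ each of which is a Laurent series in $q$ with integer coefficients and leading term $q^{-1}$. For $N\in\{3,6,12\}$ and $n\in\mathbb Z$ let $c_N(n)$ be the coefficient of $q^n$ in $j_N$. Define the mock theta functions $$f_3(q)=\sum_{n\ge0}\frac{q^{n^2}}{(-q,q)_n^2},\qquad \phi_3(q)=\sum_{n\ge0}\frac{q^{n^2}}{(-q^2,q^2)_n},\qquad \phi_6(q)=\sum_{n\ge0}\frac{(-1)^nq^{n^2}(q,q^2)_n}{(-q,q)_{2n}},$$ $$\psi_6(q)=\sum_{n\ge0}\frac{(-1)^nq^{(n+1)^2}(q,q^2)_n}{(-q,q)_{2n+1}},\qquad \lambda_6(q)=\sum_{n\ge0}\frac{(-1)^nq^n(q,q^2)_n}{(-q,q)_n},$$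 $$2\mu_6(q)=1+\sum_{n\ge0}\frac{(-1)^nq^{n+1}(1+q^n)(q,q^2)_n}{(-q,q)_{n+1}},$$ write $c_f(n)$ for the coefficient of $q^n$ in such a series $f$, and let $p(n)$ be the number of partitions of $n$. Then $c_3(n)\equiv c_6(n)\equiv c_{12}(n)\pmod 2$ for all $n\ge1$, and for all integers $n\ge0$: 1. $c_3(2n)\equiv c_3(4n+1)\equiv c_3(12n+7)\equiv c_3(24n+11)\equiv0\pmod2$. 2. $c_3(24n-1)\equiv c_{f_3}(n)\equiv c_{\phi_3}(n)\equiv c_{\phi_6}(n)\equiv c_{2\mu_6}(2n)\equiv p(n)\pmod2$. 3. $c_3(24n-9)\equiv c_{\psi_6}(n)\pmod2$. 4. $c_3(24n+3)\equiv1\pmod2$ if and only if $n=\frac{k(k+1)}2$ for some integer $k\ge0$. 5. $c_3(12n+3)\equiv c_{\lambda_6}(n)\pmod2$. -/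

import Mathlib

noncomputable section

namespace HauptMock

open PowerSeries Filter
open scoped PowerSeries.WithPiTopology

/-- The finite `q`-Pochhammer symbol `(a, b)_n = ∏_{k=0}^{n-1} (1 - a b^k)`, with base `b`. -/
def qPoch (a b : ℤ⟦X⟧) (n : ℕ) : ℤ⟦X⟧ :=
  ∏ k ∈ Finset.range n, (1 - a * b ^ k)

/-- The infinite product `(q^k)_∞ = ∏_{n ≥ 1} (1 - q^{kn})` (used only for `k ≥ 1`),
as a convergent product of formal power series in `q = X`. -/
def qInf (k : ℕ) : ℤ⟦X⟧ :=
  ∏' n : ℕ, (1 - (X ^ k) ^ (n + 1))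

/-- The quotient `a / b` of two integral power series, where `b` has constant coefficient `1`. -/
def frac (a b : ℤ⟦X⟧) : ℤ⟦X⟧ :=
  a * invOfUnit b 1

theorem frac_mul_cancel (a : ℤ⟦X⟧) {b : ℤ⟦X⟧} (hb : constantCoeff b = 1) :
    frac a b * b = a := by
  rw [frac, mul_assoc, invOfUnit_mul b 1 (by simpa using hb), mul_one]

theorem multipliable_qInf {k : ℕ} (hk : 1 ≤ k) :
    Multipliable fun n : ℕ ↦ (1 : ℤ⟦X⟧) - (X ^ k) ^ (n + 1) := by
  simp_rw [sub_eq_add_neg]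
  apply PowerSeries.WithPiTopology.multipliable_one_add_of_tendsto_order_atTop_nhds_top
  refine ENat.tendsto_nhds_top_iff_natCast_lt.mpr (fun n ↦ Filter.eventually_atTop.mpr ⟨n, ?_⟩)
  intro m hm
  rw [order_neg, ← pow_mul, order_X_pow]
  norm_cast
  nlinarith

theorem constantCoeff_qInf {k : ℕ} (hk : 1 ≤ k) : constantCoeff (qInf k) = 1 := by
  have hk' : k ≠ 0 := by omega
  rw [qInf, (multipliable_qInf hk).map_tprod (constantCoeff (R := ℤ))
    (PowerSeries.WithPiTopology.continuous_constantCoeff ℤ)]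
  simp [hk']

theorem constantCoeff_qPoch {a : ℤ⟦X⟧} (b : ℤ⟦X⟧) (ha : constantCoeff a = 0) (n : ℕ) :
    constantCoeff (qPoch a b n) = 1 := by
  simp [qPoch, map_prod, ha]

/-! ### Hauptmoduln

With `η(q) = q^{1/24} (q)_∞` and `η_k = η(q^k)`, a quotient `∏ η_k^{r_k}` has the expansion
`q^{(∑ k r_k)/24} ∏ (q^k)_∞^{r_k}`; in each case below `∑ k r_k = -24`, so the leading power
is `q^{-1}`. -/

/-- The Laurent series `q^{-1} F(q)`. -/
def qInvMul (F : ℤ⟦X⟧) : LaurentSeries ℤ :=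
  HahnSeries.single (-1) 1 * HahnSeries.ofPowerSeries ℤ ℤ F

/-- `j_3 = η_1^12 / η_3^12`. -/
def j3 : LaurentSeries ℤ :=
  qInvMul (frac (qInf 1 ^ 12) (qInf 3 ^ 12))

/-- `j_6 = η_2^3 η_3^9 / (η_1^3 η_6^9)`. -/
def j6 : LaurentSeries ℤ :=
  qInvMul (frac (qInf 2 ^ 3 * qInf 3 ^ 9) (qInf 1 ^ 3 * qInf 6 ^ 9))

/-- `j_12 = η_4^4 η_6^2 / (η_2^2 η_12^4)`. -/
def j12 : LaurentSeries ℤ :=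
  qInvMul (frac (qInf 4 ^ 4 * qInf 6 ^ 2) (qInf 2 ^ 2 * qInf 12 ^ 4))

/-- `c_3(n)`: the coefficient of `q^n` in `j_3`. -/
def c3 (n : ℤ) : ℤ := j3.coeff n

/-- `c_6(n)`: the coefficient of `q^n` in `j_6`. -/
def c6 (n : ℤ) : ℤ := j6.coeff n

/-- `c_12(n)`: the coefficient of `q^n` in `j_12`. -/
def c12 (n : ℤ) : ℤ := j12.coeff n

/-! ### Mock theta functions, as convergent sums of formal power series in `q = X` -/

/-- `f_3(q) = ∑ q^{n^2} / (-q, q)_n^2`. -/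
def f3 : ℤ⟦X⟧ :=
  ∑' n : ℕ, frac (X ^ (n ^ 2)) (qPoch (-X) X n ^ 2)

/-- `φ_3(q) = ∑ q^{n^2} / (-q^2, q^2)_n`. -/
def phi3 : ℤ⟦X⟧ :=
  ∑' n : ℕ, frac (X ^ (n ^ 2)) (qPoch (-X ^ 2) (X ^ 2) n)

/-- `φ_6(q) = ∑ (-1)^n q^{n^2} (q, q^2)_n / (-q, q)_{2n}`. -/
def phi6 : ℤ⟦X⟧ :=
  ∑' n : ℕ, frac ((-1) ^ n * X ^ (n ^ 2) * qPoch X (X ^ 2) n) (qPoch (-X) X (2 * n))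

/-- `ψ_6(q) = ∑ (-1)^n q^{(n+1)^2} (q, q^2)_n / (-q, q)_{2n+1}`. -/
def psi6 : ℤ⟦X⟧ :=
  ∑' n : ℕ, frac ((-1) ^ n * X ^ ((n + 1) ^ 2) * qPoch X (X ^ 2) n) (qPoch (-X) X (2 * n + 1))

/-- `λ_6(q) = ∑ (-1)^n q^n (q, q^2)_n / (-q, q)_n`. -/
def lambda6 : ℤ⟦X⟧ :=
  ∑' n : ℕ, frac ((-1) ^ n * X ^ n * qPoch X (X ^ 2) n) (qPoch (-X) X n)

/-- `2 μ_6(q) = 1 + ∑ (-1)^n q^{n+1} (1 + q^n) (q, q^2)_n / (-q, q)_{n+1}`. -/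
def twoMu6 : ℤ⟦X⟧ :=
  1 + ∑' n : ℕ,
    frac ((-1) ^ n * X ^ (n + 1) * (1 + X ^ n) * qPoch X (X ^ 2) n) (qPoch (-X) X (n + 1))

/-! The sums above converge. -/

theorem summable_of_X_pow_dvd {t : ℕ → ℤ⟦X⟧} (h : ∀ n, (X : ℤ⟦X⟧) ^ n ∣ t n) : Summable t := by
  apply PowerSeries.WithPiTopology.summable_of_tendsto_order_atTop_nhds_top
  refine ENat.tendsto_nhds_top_iff_natCast_lt.mpr fun n ↦ eventually_atTop.mpr ⟨n + 1, ?_⟩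
  intro m hm
  have h1 : (m : ℕ∞) ≤ (t m).order :=
    le_order _ _ fun i hi ↦ (X_pow_dvd_iff.mp (h m)) i (by exact_mod_cast hi)
  exact lt_of_lt_of_le (by exact_mod_cast hm) h1

theorem X_pow_dvd_frac {m n : ℕ} (h : n ≤ m) (a b c : ℤ⟦X⟧) :
    (X : ℤ⟦X⟧) ^ n ∣ frac (a * X ^ m * b) c :=
  Dvd.dvd.mul_right (Dvd.dvd.mul_right (Dvd.dvd.mul_left (pow_dvd_pow X h) a) b) _

theorem summable_f3 : Summable fun n : ℕ ↦ frac (X ^ (n ^ 2)) (qPoch (-X) X n ^ 2) :=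
  summable_of_X_pow_dvd fun n ↦ by
    simpa using X_pow_dvd_frac (Nat.le_self_pow two_ne_zero n) 1 1 _

theorem summable_phi3 :
    Summable fun n : ℕ ↦ frac (X ^ (n ^ 2)) (qPoch (-X ^ 2) (X ^ 2) n) :=
  summable_of_X_pow_dvd fun n ↦ by
    simpa using X_pow_dvd_frac (Nat.le_self_pow two_ne_zero n) 1 1 _

theorem summable_phi6 :
    Summable fun n : ℕ ↦
      frac ((-1) ^ n * X ^ (n ^ 2) * qPoch X (X ^ 2) n) (qPoch (-X) X (2 * n)) :=
  summable_of_X_pow_dvd fun n ↦ X_pow_dvd_frac (Nat.le_self_pow two_ne_zero n) _ _ _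

theorem summable_psi6 :
    Summable fun n : ℕ ↦
      frac ((-1) ^ n * X ^ ((n + 1) ^ 2) * qPoch X (X ^ 2) n) (qPoch (-X) X (2 * n + 1)) :=
  summable_of_X_pow_dvd fun n ↦ X_pow_dvd_frac (by nlinarith) _ _ _

theorem summable_lambda6 :
    Summable fun n : ℕ ↦ frac ((-1) ^ n * X ^ n * qPoch X (X ^ 2) n) (qPoch (-X) X n) :=
  summable_of_X_pow_dvd fun _ ↦ X_pow_dvd_frac le_rfl _ _ _

theorem summable_twoMu6 :
    Summable fun n : ℕ ↦
      frac ((-1) ^ n * X ^ (n + 1) * (1 + X ^ n) * qPoch X (X ^ 2) n) (qPoch (-X) X (n + 1)) :=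
  summable_of_X_pow_dvd fun n ↦ by
    rw [mul_assoc _ (1 + X ^ n : ℤ⟦X⟧)]
    exact X_pow_dvd_frac (Nat.le_succ n) _ _ _

end HauptMock

end

noncomputable section

namespace HauptMock

open PowerSeries Filter Finset
open scoped PowerSeries.WithPiTopology

/-! ### Convergence of power series over `ZMod 2` -/

/-! Everything happens in characteristic 2. Write E_k for (q^k)_∞ (`eta k`) and (q^s;q^d) for
`qTprod s d`. Squaring is q → q², so E_k² = E_{2k}, and signs disappear. Hence q j_3 and q j_12 both
reduce to H = E_1^12/E_3^12, while q j_6 reduces to E_1^3/E_3^9.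

The theta series θ = Σ q^(3n²+2n) equals E_3^3/E_1 by the Jacobi triple product. Splitting n by
parity gives θ = E_1^8 + qθ^4 (`theta_one`). Multiplied by E_1^4 this reads E_1^3 E_3^3 = E_1^12 + q
E_3^12, so q j_6 ≡ H + q and only the constant term of j_6 differs.

For the coefficients, H is E_1^3/E_3^3 at q^4. Gauss's series for E_1^3 has the 3-dissection E_1^3 =
E_3 + q E_9^3. Hence E_1^3/E_3^3 = 1/E_6 + q E_9^3/E_3^3. Finally θ = E_1^8 + qθ^4, divided by E_1²,
is a 2-dissection of E_3^3/E_1^3 = θ/E_1².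

The mock theta functions enter because modulo 2 they are products: f_3, φ_3, φ_6 ≡ 1/E_1 (Cauchy),
which also generates p(n); 2μ_6 ≡ 1/E_1² (telescoping); λ_6 ≡ θ/E_1² and ψ_6 ≡ qθ²/E_1. The last two
rest on Σ q^(n²+n)/(q;q²)_{n+1} = θ, a Rogers–Fine sum equal to θ², and transformations of Euler and
Heine type. Most of these sums are evaluated by inserting a parameter k, finding a recurrence in k
by telescoping, and iterating it. -/

theorem eq_of_forall_X_pow_dvd_sub {R : Type*} [CommRing R] {a b : R⟦X⟧}
    (h : ∀ N, (X : R⟦X⟧) ^ N ∣ a - b) : a = b := by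
  ext n
  have := X_pow_dvd_iff.mp (h (n + 1)) n (Nat.lt_succ_self n)
  rwa [map_sub, sub_eq_zero] at this

theorem coeff_tsum {ι : Type*} {f : ι → (ZMod 2)⟦X⟧} (hf : Summable f) (d : ℕ) :
    coeff d (∑' i, f i) = ∑' i, coeff d (f i) :=
  ((WithPiTopology.hasSum_iff_hasSum_coeff _).mp hf.hasSum d).tsum_eq.symm

theorem summable_of_forall_X_pow_dvd {f : ℕ → (ZMod 2)⟦X⟧} (h : ∀ n, X ^ n ∣ f n) :
    Summable f := by
  rw [WithPiTopology.summable_iff_summable_coeff]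
  intro d
  refine summable_of_hasFiniteSupport <| (Set.finite_Iic d).subset fun n hn ↦ ?_
  contrapose! hn
  simpa using X_pow_dvd_iff.mp (h n) d (by simpa using hn)

theorem summable_prod_of_forall_X_pow_dvd {f : ℕ × ℕ → (ZMod 2)⟦X⟧}
    (h : ∀ p, X ^ (p.1 + p.2) ∣ f p) : Summable f := by
  rw [WithPiTopology.summable_iff_summable_coeff]
  intro d
  refine summable_of_hasFiniteSupport <|
    ((Set.finite_Iic d).prod (Set.finite_Iic d)).subset fun p hp ↦ ?_
  contrapose! hp
  have : d < p.1 + p.2 := by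
    simp only [Set.mem_prod, Set.mem_Iic] at hp
    omega
  simpa using X_pow_dvd_iff.mp (h p) d this

theorem X_pow_dvd_tsum {ι : Type*} {f : ι → (ZMod 2)⟦X⟧} {N : ℕ} (h : ∀ i, X ^ N ∣ f i) :
    X ^ N ∣ ∑' i, f i := by
  by_cases hf : Summable f
  · rw [X_pow_dvd_iff]
    intro m hm
    rw [coeff_tsum hf]
    simp [fun i ↦ X_pow_dvd_iff.mp (h i) m hm]
  -- A non-summable `tsum` is 0 by convention, so no summability hypothesis is needed.
  · simp [tsum_eq_zero_of_not_summable hf]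

theorem X_pow_dvd_tsum_sub_sum {f : ℕ → (ZMod 2)⟦X⟧} (h : ∀ n, X ^ n ∣ f n) (N : ℕ) :
    X ^ N ∣ ∑' n, f n - ∑ n ∈ range N, f n := by
  rw [← (summable_of_forall_X_pow_dvd h).sum_add_tsum_nat_add N, add_sub_cancel_left]
  exact X_pow_dvd_tsum fun i ↦ (pow_dvd_pow X (Nat.le_add_left N i)).trans (h _)

theorem tsum_sub_succ {c : ℕ → (ZMod 2)⟦X⟧} (h : ∀ n, X ^ n ∣ c n) :
    ∑' n, (c n - c (n + 1)) = c 0 := by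
  have h1 := summable_of_forall_X_pow_dvd h
  have h2 : Summable fun n ↦ c (n + 1) := (summable_nat_add_iff 1).mpr h1
  rw [h1.tsum_sub h2, h1.tsum_eq_zero_add, add_sub_cancel_right]

/-- If `F k = A k + B k * F (k + 1)`, where `X ∣ B k`, then iterating this relation expresses `F 0`
as an infinite sum. -/
theorem tsum_of_recurrence {F A B : ℕ → (ZMod 2)⟦X⟧} (hB : ∀ k, X ∣ B k)
    (h : ∀ k, F k = A k + B k * F (k + 1)) :
    ∑' k, A k * ∏ i ∈ range k, B i = F 0 := by
  have hdvd : ∀ k, X ^ k ∣ ∏ i ∈ range k, B i := fun k ↦ by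
    simpa using Finset.prod_dvd_prod_of_dvd (s := range k) (fun _ ↦ (X : (ZMod 2)⟦X⟧)) B
      fun i _ ↦ hB i
  have := tsum_sub_succ (c := fun k ↦ (∏ i ∈ range k, B i) * F k) fun k ↦ (hdvd k).mul_right _
  simp only [range_zero, prod_empty, one_mul] at this
  rw [← this]
  refine tsum_congr fun k ↦ ?_
  rw [prod_range_succ, h k]
  ring

/-- Truncation modulo `X ^ N`. -/
abbrev modX (N : ℕ) : (ZMod 2)⟦X⟧ →+* (ZMod 2)⟦X⟧ ⧸ Ideal.span {(X : (ZMod 2)⟦X⟧) ^ N} :=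
  Ideal.Quotient.mk _

theorem modX_eq_iff {N : ℕ} {a b : (ZMod 2)⟦X⟧} : modX N a = modX N b ↔ X ^ N ∣ a - b := by
  rw [Ideal.Quotient.eq, Ideal.mem_span_singleton]

/-- Modulo each X^N infinite sums and products become finite, so limit arguments turn into ring
identities in the quotients. -/
theorem eq_of_forall_modX {a b : (ZMod 2)⟦X⟧} (h : ∀ N, modX N a = modX N b) : a = b :=
  eq_of_forall_X_pow_dvd_sub fun N ↦ modX_eq_iff.mp (h N)

theorem modX_eq_zero {N : ℕ} {a : (ZMod 2)⟦X⟧} (h : X ^ N ∣ a) : modX N a = 0 := by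
  rwa [Ideal.Quotient.eq_zero_iff_mem, Ideal.mem_span_singleton]

theorem modX_tsum {f : ℕ → (ZMod 2)⟦X⟧} (h : ∀ n, X ^ n ∣ f n) (N : ℕ) :
    modX N (∑' n, f n) = ∑ n ∈ range N, modX N (f n) := by
  rw [modX_eq_iff.mpr (X_pow_dvd_tsum_sub_sum h N), map_sum]

/-! ### Finite and infinite `q`-products over `ZMod 2` -/

/-- The finite product `(q^s, q^d)_n` over `ZMod 2`. -/
def qProd (s d n : ℕ) : (ZMod 2)⟦X⟧ := ∏ k ∈ range n, (1 - X ^ (s + d * k))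

/-- The infinite product `(q^s, q^d)_∞` over `ZMod 2`. -/
def qTprod (s d : ℕ) : (ZMod 2)⟦X⟧ := ∏' k : ℕ, (1 - X ^ (s + d * k))

@[simp] theorem qProd_zero (s d : ℕ) : qProd s d 0 = 1 := by simp [qProd]

theorem qProd_succ (s d n : ℕ) : qProd s d (n + 1) = qProd s d n * (1 - X ^ (s + d * n)) :=
  prod_range_succ _ _

theorem qProd_add (s d m n : ℕ) : qProd s d (m + n) = qProd s d m * qProd (s + d * m) d n := by
  rw [qProd, prod_range_add, qProd, qProd]
  congr 1
  refine prod_congr rfl fun k _ ↦ ?_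
  ring_nf

theorem qProd_succ' (s d n : ℕ) : qProd s d (n + 1) = (1 - X ^ s) * qProd (s + d) d n := by
  rw [add_comm n 1, qProd_add]
  simp [qProd]

theorem two_eq_zero : (2 : (ZMod 2)⟦X⟧) = 0 := by
  rw [← map_ofNat (C : ZMod 2 →+* (ZMod 2)⟦X⟧) 2, show (OfNat.ofNat 2 : ZMod 2) = 0 from rfl,
    map_zero]

theorem sq_one_sub (a : (ZMod 2)⟦X⟧) : (1 - a) ^ 2 = 1 - a ^ 2 := by
  linear_combination (a ^ 2 - a) * two_eq_zero

theorem qProd_sq (s d n : ℕ) : qProd s d n ^ 2 = qProd (2 * s) (2 * d) n := by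
  rw [qProd, qProd, ← prod_pow]
  refine prod_congr rfl fun k _ ↦ ?_
  rw [sq_one_sub]
  ring_nf

theorem qProd_two_mul (s d n : ℕ) :
    qProd s d (2 * n) = qProd s (2 * d) n * qProd (s + d) (2 * d) n := by
  induction n with
  | zero => simp
  | succ n ih =>
    rw [show 2 * (n + 1) = 2 * n + 1 + 1 by ring, qProd_succ, qProd_succ, ih, qProd_succ, qProd_succ]
    ring_nf

theorem qProd_three_mul (s d n : ℕ) :
    qProd s d (3 * n) =
      qProd s (3 * d) n * qProd (s + d) (3 * d) n * qProd (s + 2 * d) (3 * d) n := by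
  induction n with
  | zero => simp
  | succ n ih =>
    rw [show 3 * (n + 1) = 3 * n + 1 + 1 + 1 by ring, qProd_succ, qProd_succ, qProd_succ, ih,
      qProd_succ, qProd_succ, qProd_succ]
    ring_nf

theorem constantCoeff_qProd {s : ℕ} (hs : 1 ≤ s) (d n : ℕ) : constantCoeff (qProd s d n) = 1 := by
  rw [qProd, map_prod]
  exact prod_eq_one fun k _ ↦ by
    rw [map_sub, map_one, map_pow, constantCoeff_X, zero_pow (by omega), sub_zero]

theorem multipliable_qTprod (s : ℕ) {d : ℕ} (hd : 1 ≤ d) :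
    Multipliable fun k : ℕ ↦ (1 : (ZMod 2)⟦X⟧) - X ^ (s + d * k) := by
  simp_rw [sub_eq_add_neg]
  apply WithPiTopology.multipliable_one_add_of_tendsto_order_atTop_nhds_top
  refine ENat.tendsto_nhds_top_iff_natCast_lt.mpr fun n ↦ eventually_atTop.mpr ⟨n + 1, ?_⟩
  intro m hm
  rw [order_neg, order_X_pow]
  norm_cast
  nlinarith

theorem qProd_sub_one_dvd (s d n : ℕ) : X ^ s ∣ qProd s d n - 1 := by
  induction n with
  | zero => simp
  | succ n ih =>
    rw [qProd_succ, mul_sub, mul_one, sub_right_comm]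
    exact dvd_sub ih (Dvd.dvd.mul_left (pow_dvd_pow X (Nat.le_add_right _ _)) _)

theorem qTprod_sub_one_dvd (s : ℕ) {d : ℕ} (hd : 1 ≤ d) : X ^ s ∣ qTprod s d - 1 := by
  rw [X_pow_dvd_iff]
  intro m hm
  have h1 := (WithPiTopology.tendsto_iff_coeff_tendsto (R := ZMod 2) _ _ _).mp
    (multipliable_qTprod s hd).hasProd.tendsto_prod_nat m
  have h2 : ∀ n, coeff m (∏ k ∈ range n, (1 - X ^ (s + d * k)) : (ZMod 2)⟦X⟧) =
      coeff m (1 : (ZMod 2)⟦X⟧) := fun n ↦ by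
    have := X_pow_dvd_iff.mp (qProd_sub_one_dvd s d n) m hm
    rwa [map_sub, sub_eq_zero] at this
  simp_rw [h2] at h1
  rw [map_sub, sub_eq_zero]
  exact tendsto_nhds_unique tendsto_const_nhds h1 |>.symm

theorem qTprod_eq_mul (s : ℕ) {d : ℕ} (hd : 1 ≤ d) (n : ℕ) :
    qTprod s d = qProd s d n * qTprod (s + d * n) d := by
  have h := Multipliable.prod_mul_tprod_nat_mul' (k := n)
    (f := fun k : ℕ ↦ (1 : (ZMod 2)⟦X⟧) - X ^ (s + d * k)) (by
      have := multipliable_qTprod (s + d * n) hd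
      convert this using 3 with k
      ring)
  rw [qTprod, ← h, qProd, qTprod]
  congr 1
  refine tprod_congr fun k ↦ ?_
  ring_nf

theorem constantCoeff_qTprod {s d : ℕ} (hs : 1 ≤ s) (hd : 1 ≤ d) :
    constantCoeff (qTprod s d) = 1 := by
  have := X_pow_dvd_iff.mp (qTprod_sub_one_dvd s hd) 0 hs
  rw [coeff_zero_eq_constantCoeff, map_sub, sub_eq_zero] at this
  simpa using this

theorem modX_qTprod_eq_one {s d N : ℕ} (hd : 1 ≤ d) (h : N ≤ s) : modX N (qTprod s d) = 1 := by
  rw [← map_one (modX N), modX_eq_iff]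
  exact (pow_dvd_pow X h).trans (qTprod_sub_one_dvd s hd)

theorem modX_qProd {s d n N : ℕ} (hd : 1 ≤ d) (h : N ≤ s + d * n) :
    modX N (qProd s d n) = modX N (qTprod s d) := by
  rw [qTprod_eq_mul s hd n, map_mul, modX_qTprod_eq_one hd h, mul_one]

theorem qTprod_sq (s : ℕ) {d : ℕ} (hd : 1 ≤ d) : qTprod s d ^ 2 = qTprod (2 * s) (2 * d) := by
  refine eq_of_forall_modX fun N ↦ ?_
  rw [map_pow, ← modX_qProd hd (n := N) (by nlinarith), ← map_pow, qProd_sq,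
    modX_qProd (by omega) (by nlinarith)]

theorem qTprod_two_mul (s : ℕ) {d : ℕ} (hd : 1 ≤ d) :
    qTprod s d = qTprod s (2 * d) * qTprod (s + d) (2 * d) := by
  refine eq_of_forall_modX fun N ↦ ?_
  rw [← modX_qProd hd (n := 2 * N) (by nlinarith), qProd_two_mul, map_mul, map_mul,
    modX_qProd (by omega) (by nlinarith), modX_qProd (by omega) (by nlinarith)]

theorem qTprod_three_mul (s : ℕ) {d : ℕ} (hd : 1 ≤ d) :
    qTprod s d = qTprod s (3 * d) * qTprod (s + d) (3 * d) * qTprod (s + 2 * d) (3 * d) := by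
  refine eq_of_forall_modX fun N ↦ ?_
  rw [← modX_qProd hd (n := 3 * N) (by nlinarith), qProd_three_mul]
  simp only [map_mul]
  rw [modX_qProd (by omega) (by nlinarith), modX_qProd (by omega) (by nlinarith),
    modX_qProd (by omega) (by nlinarith)]

/-- If `F k * u k = F (k + 1) * v k` and `F k → 1`, then `F 0 * ∏ u = ∏ v`. -/
theorem mul_qTprod_of_recurrence {F : ℕ → (ZMod 2)⟦X⟧} {a b d e : ℕ} (hd : 1 ≤ d) (he : 1 ≤ e)
    (hF : ∀ k, X ^ k ∣ F k - 1)
    (h : ∀ k, F k * (1 - X ^ (a + d * k)) = F (k + 1) * (1 - X ^ (b + e * k))) :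
    F 0 * qTprod a d = qTprod b e := by
  have key : ∀ n, F 0 * qProd a d n = F n * qProd b e n := fun n ↦ by
    induction n with
    | zero => simp
    | succ n ih => rw [qProd_succ, qProd_succ, ← mul_assoc, ih]; linear_combination qProd b e n * h n
  refine eq_of_forall_modX fun N ↦ ?_
  rw [map_mul, ← modX_qProd hd (n := N) (by nlinarith), ← map_mul, key, map_mul,
    modX_eq_iff.mpr (hF N), map_one, one_mul, modX_qProd he (by nlinarith)]

/-- `F k * (1 - X ^ (a + d * k)) = F (k + 1)` and `F k → 1` force `F 0 = 1 / (X ^ a; X ^ d)_∞`. -/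
theorem mul_qTprod_eq_one_of_recurrence {F : ℕ → (ZMod 2)⟦X⟧} {a d : ℕ} (hd : 1 ≤ d)
    (hF : ∀ k, X ^ k ∣ F k - 1) (h : ∀ k, F k * (1 - X ^ (a + d * k)) = F (k + 1)) :
    F 0 * qTprod a d = 1 := by
  have key : ∀ n, F 0 * qProd a d n = F n := fun n ↦ by
    induction n with
    | zero => simp
    | succ n ih => rw [qProd_succ, ← mul_assoc, ih, h]
  refine eq_of_forall_modX fun N ↦ ?_
  rw [map_mul, ← modX_qProd hd (n := N) (by nlinarith), ← map_mul, key, modX_eq_iff.mpr (hF N)]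

theorem tsum_sub_zeroth_dvd {f : ℕ → (ZMod 2)⟦X⟧} (hs : ∀ n, X ^ n ∣ f n) {N : ℕ}
    (h : ∀ n, X ^ N ∣ f (n + 1)) : X ^ N ∣ ∑' n, f n - f 0 := by
  rw [(summable_of_forall_X_pow_dvd hs).tsum_eq_zero_add, add_sub_cancel_left]
  exact X_pow_dvd_tsum h

/-! ### The Jacobi triple product over `ZMod 2` -/

/-- The Gaussian binomial coefficient in base `X ^ d`, over `ZMod 2`. -/
def gaussBinom (d : ℕ) : ℕ → ℕ → (ZMod 2)⟦X⟧
  | _, 0 => 1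
  | 0, _ + 1 => 0
  | m + 1, j + 1 => gaussBinom d m j + X ^ (d * (j + 1)) * gaussBinom d m (j + 1)

@[simp] theorem gaussBinom_zero_right (d m : ℕ) : gaussBinom d m 0 = 1 := by
  cases m <;> simp [gaussBinom]

theorem gaussBinom_succ_succ (d m j : ℕ) : gaussBinom d (m + 1) (j + 1) =
    gaussBinom d m j + X ^ (d * (j + 1)) * gaussBinom d m (j + 1) := rfl

theorem gaussBinom_eq_zero_of_lt (d : ℕ) {m j : ℕ} (h : m < j) : gaussBinom d m j = 0 := by
  induction m generalizing j with
  | zero => obtain ⟨j, rfl⟩ := Nat.exists_eq_add_of_lt h; simp [gaussBinom]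
  | succ m ih =>
    obtain ⟨j, rfl⟩ := Nat.exists_eq_succ_of_ne_zero (show j ≠ 0 by omega)
    rw [Nat.succ_eq_add_one, gaussBinom_succ_succ, ih (by omega), ih (by omega)]
    simp

/-- The quotient formula for the Gaussian binomial with denominators cleared. Pascal's rule
preserves it because (1 - q^(da)) + q^(da)(1 - q^(db)) = 1 - q^(d(a+b)). -/
theorem gaussBinom_mul (d : ℕ) {m i j : ℕ} (h : i + j = m) :
    gaussBinom d m j * (qProd d d j * qProd d d i) = qProd d d m := by
  induction m generalizing i j with
  | zero =>
    obtain ⟨rfl, rfl⟩ : i = 0 ∧ j = 0 := by omega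
    simp
  | succ m ih =>
    rcases j with _ | j
    · obtain rfl : i = m + 1 := by omega
      simp
    · have h1 := ih (i := i) (j := j) (by omega)
      rw [gaussBinom_succ_succ, qProd_succ d d j, qProd_succ d d m]
      rcases i with _ | i
      · obtain rfl : j = m := by omega
        rw [gaussBinom_eq_zero_of_lt d (Nat.lt_succ_self j)]
        linear_combination (1 - X ^ (d + d * j)) * h1
      · have h2 := ih (i := i) (j := j + 1) (by omega)
        rw [qProd_succ] at h2
        rw [qProd_succ d d i] at h1 ⊢
        obtain rfl : i + j + 1 = m := by omega
        linear_combination (1 - X ^ (d + d * j)) * h1 +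
          X ^ (d * (j + 1)) * (1 - X ^ (d + d * i)) * h2

theorem choose_two_succ (j : ℕ) : (j + 1).choose 2 = j.choose 2 + j := by
  rw [Nat.choose_succ_succ' j 1, Nat.choose_one_right, add_comm]

theorem choose_two_add (n i : ℕ) : (n + i).choose 2 = n.choose 2 + i.choose 2 + n * i := by
  induction i with
  | zero => simp
  | succ i ih => rw [← add_assoc, choose_two_succ, ih, choose_two_succ]; ring

theorem two_mul_choose_two_succ (i : ℕ) : 2 * (i + 1).choose 2 = (i + 1) * i := by
  induction i with
  | zero => simp
  | succ i ih => rw [choose_two_succ, mul_add, ih]; ring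

theorem prod_range_X_pow_mul (d n : ℕ) :
    ∏ k ∈ range n, (X : (ZMod 2)⟦X⟧) ^ (d * k) = X ^ (d * n.choose 2) := by
  induction n with
  | zero => simp
  | succ n ih => rw [prod_range_succ, ih, choose_two_succ]; ring

/-- The `q`-binomial theorem. -/
theorem prod_add_mul_X_pow (d m : ℕ) (x y : (ZMod 2)⟦X⟧) :
    ∏ k ∈ range m, (y + x * X ^ (d * k)) =
      ∑ j ∈ range (m + 1), gaussBinom d m j * X ^ (d * j.choose 2) * x ^ j * y ^ (m - j) := by
  induction m generalizing x with
  | zero => simp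
  | succ m ih =>
    have hstep : ∏ k ∈ range m, (y + x * X ^ (d * (k + 1))) =
        ∏ k ∈ range m, (y + x * X ^ d * X ^ (d * k)) :=
      prod_congr rfl fun k _ ↦ by ring
    -- Pascal's rule splits the coefficient of x^(j+1). The two parts sum to x and to y times the
    -- same product, shifted by x → x q^d; together they restore the factor y + x at k = 0.
    have h1 : ∑ j ∈ range (m + 1), gaussBinom d m j * X ^ (d * (j + 1).choose 2) *
        x ^ (j + 1) * y ^ (m - j) = x * ∏ k ∈ range m, (y + x * X ^ d * X ^ (d * k)) := by
      rw [ih, mul_sum]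
      refine sum_congr rfl fun j _ ↦ ?_
      rw [choose_two_succ]
      ring
    have h2 : y ^ (m + 1) + ∑ j ∈ range (m + 1), X ^ (d * (j + 1)) * gaussBinom d m (j + 1) *
        X ^ (d * (j + 1).choose 2) * x ^ (j + 1) * y ^ (m - j) =
        y * ∏ k ∈ range m, (y + x * X ^ d * X ^ (d * k)) := by
      rw [sum_range_succ, gaussBinom_eq_zero_of_lt d (Nat.lt_succ_self m), ih, sum_range_succ',
        mul_add y, mul_sum]
      have : ∀ j ∈ range m, X ^ (d * (j + 1)) * gaussBinom d m (j + 1) *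
          X ^ (d * (j + 1).choose 2) * x ^ (j + 1) * y ^ (m - j) =
          y * (gaussBinom d m (j + 1) * X ^ (d * (j + 1).choose 2) * (x * X ^ d) ^ (j + 1) *
            y ^ (m - (j + 1))) := fun j hj ↦ by
        rw [mem_range] at hj
        obtain ⟨r, rfl⟩ := Nat.exists_eq_add_of_lt hj
        rw [show j + r + 1 - j = r + 1 by omega, show j + r + 1 - (j + 1) = r by omega]
        ring
      rw [sum_congr rfl this]
      simp
      ring
    rw [prod_range_succ', hstep, mul_zero, pow_zero, mul_one, sum_range_succ']
    simp only [gaussBinom_succ_succ, Nat.add_sub_add_right, add_mul, sum_add_distrib]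
    simp only [gaussBinom_zero_right, pow_zero, mul_one, Nat.sub_zero, Nat.choose_zero_succ,
      mul_zero, one_mul]
    linear_combination -h1 - h2

theorem add_eq_sub' (a b : (ZMod 2)⟦X⟧) : a + b = a - b := by
  linear_combination b * two_eq_zero

/-- The q-binomial theorem with 2(N+1) factors, x = 1 and y = q^(dN+s), where d = s + t. Pulling
q^(dk) out of the factors with k ≤ N and q^(dN+s) out of the others leaves the two products; A is
the total exponent pulled out. Expanding around the middle index j = N + 1 gives the two sums,
without negative powers of q. -/
theorem finite_jacobi_triple_product (s t N : ℕ) :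
    qProd s (s + t) (N + 1) * qProd t (s + t) (N + 1) =
      ∑ i ∈ range (N + 2), gaussBinom (s + t) (2 * (N + 1)) (N + 1 + i) *
          X ^ ((s + t) * i.choose 2 + t * i) +
        ∑ i ∈ range (N + 1), gaussBinom (s + t) (2 * (N + 1)) (N - i) *
          X ^ ((s + t) * (i + 1).choose 2 + s * (i + 1)) := by
  set d := s + t with hd
  set A := d * (N + 1).choose 2 + (N + 1) * (d * N + s) with hA
  have h := prod_add_mul_X_pow d (2 * (N + 1)) 1 (X ^ (d * N + s))
  have hl : ∏ k ∈ range (2 * (N + 1)), ((X : (ZMod 2)⟦X⟧) ^ (d * N + s) + 1 * X ^ (d * k)) =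
      X ^ A * (qProd s d (N + 1) * qProd t d (N + 1)) := by
    rw [two_mul, prod_range_add, ← prod_range_reflect _ (N + 1)]
    have h1 : ∏ j ∈ range (N + 1),
        ((X : (ZMod 2)⟦X⟧) ^ (d * N + s) + 1 * X ^ (d * (N + 1 - 1 - j))) =
        X ^ (d * (N + 1).choose 2) * qProd s d (N + 1) := by
      rw [← prod_range_X_pow_mul, ← prod_range_reflect (fun k ↦ (X : (ZMod 2)⟦X⟧) ^ (d * k)), qProd,
        ← prod_mul_distrib]
      refine prod_congr rfl fun k hk ↦ ?_
      rw [mem_range] at hk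
      obtain ⟨j, rfl⟩ := Nat.exists_eq_add_of_le (show k ≤ N by omega)
      rw [show k + j + 1 - 1 - k = j by omega, ← add_eq_sub']
      ring
    have h2 : ∏ k ∈ range (N + 1),
        ((X : (ZMod 2)⟦X⟧) ^ (d * N + s) + 1 * X ^ (d * (N + 1 + k))) =
        X ^ ((N + 1) * (d * N + s)) * qProd t d (N + 1) := by
      rw [mul_comm (N + 1), pow_mul, ← card_range (N + 1), ← prod_const, card_range, qProd,
        ← prod_mul_distrib]
      refine prod_congr rfl fun k _ ↦ ?_
      rw [← add_eq_sub', hd]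
      ring
    rw [h1, h2, hA]
    ring
  rw [hl] at h
  refine mul_left_cancel₀ (pow_ne_zero A (X_ne_zero (R := ZMod 2))) (h.trans ?_)
  rw [show 2 * (N + 1) + 1 = (N + 1) + (N + 2) by ring, sum_range_add, ← sum_range_reflect _ (N + 1),
    add_comm, mul_add (X ^ A), mul_sum, mul_sum]
  congr 1
  · refine sum_congr rfl fun i hi ↦ ?_
    rw [mem_range] at hi
    obtain ⟨r, hr⟩ := Nat.exists_eq_add_of_le (show i ≤ N + 1 by omega)
    rw [show 2 * (N + 1) - (N + 1 + i) = r by omega, ← pow_mul, one_pow, mul_one]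
    have : d * (N + 1 + i).choose 2 + (d * N + s) * r = A + (d * i.choose 2 + t * i) := by
      rw [choose_two_add, hA]
      zify
      rw [show (r : ℤ) = N + 1 - i by omega, hd]
      push_cast
      ring
    rw [mul_assoc, ← pow_add, this]
    ring
  · refine sum_congr rfl fun i hi ↦ ?_
    rw [mem_range] at hi
    obtain ⟨j, rfl⟩ := Nat.exists_eq_add_of_le (show i ≤ N by omega)
    rw [show i + j + 1 - 1 - i = j by omega, show i + j - i = j by omega,
      show 2 * (i + j + 1) - j = i + j + 1 + (i + 1) by omega, ← pow_mul, one_pow, mul_one]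
    have : d * j.choose 2 + (d * (i + j) + s) * (i + j + 1 + (i + 1)) =
        A + (d * (i + 1).choose 2 + s * (i + 1)) := by
      have h2 := two_mul_choose_two_succ i
      rw [hA, show i + j + 1 = j + (i + 1) by ring, choose_two_add]
      zify at h2 ⊢
      linear_combination -(d : ℤ) * h2
    rw [mul_assoc, ← pow_add, this]
    ring

/-- Modulo X^M all three products in `gaussBinom_mul` equal E_d, so the binomial becomes 1/E_d. -/
theorem modX_qTprod_mul_gaussBinom {d m i j M : ℕ} (hd : 1 ≤ d) (h : i + j = m) (hi : M ≤ i)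
    (hj : M ≤ j) : modX M (qTprod d d * gaussBinom d m j) = 1 := by
  have h1 := congrArg (modX M) (gaussBinom_mul d h)
  rw [map_mul, map_mul, modX_qProd hd (by nlinarith), modX_qProd hd (by nlinarith),
    modX_qProd hd (by nlinarith)] at h1
  have hu : IsUnit (modX M (qTprod d d)) :=
    (isUnit_iff_constantCoeff.mpr (by rw [constantCoeff_qTprod hd hd]; exact isUnit_one)).map _
  refine hu.mul_left_cancel ?_
  rw [map_mul]
  linear_combination h1

theorem modX_tsum_of_le {f : ℕ → (ZMod 2)⟦X⟧} (h : ∀ n, X ^ n ∣ f n) {M N : ℕ} (hMN : M ≤ N) :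
    modX M (∑' n, f n) = ∑ n ∈ range N, modX M (f n) := by
  rw [← map_sum, modX_eq_iff]
  exact (pow_dvd_pow X hMN).trans (X_pow_dvd_tsum_sub_sum h N)

/-- The Jacobi triple product identity, over `ZMod 2`. -/
theorem jacobi_triple_product {s t : ℕ} (hs : 1 ≤ s) (ht : 1 ≤ t) :
    qTprod s (s + t) * qTprod t (s + t) * qTprod (s + t) (s + t) =
      ∑' i : ℕ, X ^ ((s + t) * i.choose 2 + t * i) +
        ∑' i : ℕ, X ^ ((s + t) * (i + 1).choose 2 + s * (i + 1)) := by
  refine eq_of_forall_modX fun M ↦ ?_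
  have hd : 1 ≤ s + t := by omega
  have he : ∀ i, i ≤ (s + t) * i.choose 2 + t * i := fun i ↦ by nlinarith
  have he' : ∀ i, i ≤ (s + t) * (i + 1).choose 2 + s * (i + 1) := fun i ↦ by nlinarith
  -- Taking N = 2M keeps both lower indices of the binomial at least M whenever i < M; the terms
  -- with i ≥ M vanish modulo X^M.
  have hfin := congrArg (fun a ↦ modX M (qTprod (s + t) (s + t) * a))
    (finite_jacobi_triple_product s t (2 * M))
  simp only [map_mul, map_add, map_sum] at hfin
  rw [mul_add, mul_sum, mul_sum, modX_qProd hd (by nlinarith), modX_qProd hd (by nlinarith)] at hfin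
  rw [map_mul, map_mul, mul_comm, hfin, map_add,
    modX_tsum_of_le (fun i ↦ pow_dvd_pow X (he i)) (show M ≤ 2 * M + 2 by omega),
    modX_tsum_of_le (fun i ↦ pow_dvd_pow X (he' i)) (show M ≤ 2 * M + 1 by omega)]
  congr 1
  · refine sum_congr rfl fun i hi ↦ ?_
    rw [mem_range] at hi
    by_cases hiM : i < M
    · rw [← mul_assoc, ← map_mul, modX_qTprod_mul_gaussBinom hd (i := 2 * M + 1 - i) (by omega)
        (by omega) (by omega), one_mul]
    · rw [modX_eq_zero (pow_dvd_pow X ((not_lt.mp hiM).trans (he i)))]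
      simp
  · refine sum_congr rfl fun i hi ↦ ?_
    rw [mem_range] at hi
    by_cases hiM : i < M
    · rw [← mul_assoc, ← map_mul, modX_qTprod_mul_gaussBinom hd (i := 2 * M + 2 + i) (by omega)
        (by omega) (by omega), one_mul]
    · rw [modX_eq_zero (pow_dvd_pow X ((not_lt.mp hiM).trans (he' i)))]
      simp

/-! ### Eta products and theta series over `ZMod 2` -/

/-- The product `(q^k)_∞ = ∏ (1 - q^(kn))` over `ZMod 2`. -/
abbrev eta (k : ℕ) : (ZMod 2)⟦X⟧ := qTprod k k

theorem eta_ne_zero {k : ℕ} (hk : 1 ≤ k) : eta k ≠ 0 := fun h ↦ by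
  simpa [h] using constantCoeff_qTprod hk hk

theorem eta_sq {k : ℕ} (hk : 1 ≤ k) : eta k ^ 2 = eta (2 * k) := qTprod_sq k hk

theorem eta_pow_four {k : ℕ} (hk : 1 ≤ k) : eta k ^ 4 = eta (4 * k) := by
  rw [show 4 = 2 * 2 by norm_num, pow_mul, eta_sq hk, eta_sq (by omega), mul_assoc]

/-- Splitting the factors of E_k by parity gives E_k = (q^k;q^(2k)) E_{2k}, and E_{2k} = E_k²; one
E_k cancels. -/
theorem qTprod_odd_mul_eta {k : ℕ} (hk : 1 ≤ k) : qTprod k (2 * k) * eta k = 1 := by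
  have h := qTprod_two_mul k hk
  rw [← two_mul] at h
  refine mul_left_cancel₀ (eta_ne_zero hk) ?_
  linear_combination qTprod k (2 * k) * eta_sq hk - h

theorem expand_qProd {k : ℕ} (hk : k ≠ 0) (s d n : ℕ) :
    expand k hk (qProd s d n) = qProd (k * s) (k * d) n := by
  rw [qProd, map_prod, qProd]
  refine prod_congr rfl fun i _ ↦ ?_
  rw [map_sub, map_one, map_pow, expand_X]
  ring_nf

theorem expand_qTprod {k : ℕ} (hk : k ≠ 0) (s : ℕ) {d : ℕ} (hd : 1 ≤ d) :
    expand k hk (qTprod s d) = qTprod (k * s) (k * d) := by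
  refine eq_of_forall_modX fun N ↦ ?_
  have hk' : 1 ≤ k := Nat.one_le_iff_ne_zero.mpr hk
  have hkd : 1 ≤ k * d := Nat.mul_pos hk' hd
  obtain ⟨b, hb⟩ := modX_eq_iff.mp
    (modX_qProd (s := s) (n := N) (N := N) hd (by nlinarith)).symm
  rw [← modX_qProd (n := N) hkd (by nlinarith), modX_eq_iff, ← expand_qProd hk, ← map_sub, hb,
    map_mul, map_pow, expand_X, ← pow_mul]
  exact (pow_dvd_pow X (by nlinarith)).mul_right _

theorem expand_eta {k : ℕ} (hk : k ≠ 0) {m : ℕ} (hm : 1 ≤ m) :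
    expand k hk (eta m) = eta (k * m) := expand_qTprod hk m hm

/-- A form of Euler's pentagonal number theorem. -/
theorem eta_eq_tsum {k : ℕ} (hk : 1 ≤ k) :
    eta k = ∑' i : ℕ, X ^ (k * (3 * i.choose 2 + 2 * i)) +
      ∑' i : ℕ, X ^ (k * (3 * (i + 1).choose 2 + (i + 1))) := by
  have h := jacobi_triple_product (s := k) (t := 2 * k) hk (by omega)
  have h3 := qTprod_three_mul k hk
  rw [show k + k = 2 * k by ring, show k + 2 * k = 3 * k by ring] at h3
  rw [show k + 2 * k = 3 * k by ring, ← h3] at h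
  rw [eta, h]
  congr 1 <;> refine tsum_congr fun i ↦ ?_ <;> ring_nf

theorem le_choose_two_succ (n : ℕ) : n ≤ (n + 1).choose 2 := by
  rw [choose_two_succ]
  omega

theorem summable_X_pow {e : ℕ → ℕ} (he : ∀ n, n ≤ e n) :
    Summable fun n ↦ (X : (ZMod 2)⟦X⟧) ^ e n :=
  summable_of_forall_X_pow_dvd fun n ↦ pow_dvd_pow X (he n)

theorem sum_range_two_mul {M : Type*} [AddCommMonoid M] (g : ℕ → M) (N : ℕ) :
    ∑ n ∈ range (2 * N), g n = ∑ n ∈ range N, g (2 * n) + ∑ n ∈ range N, g (2 * n + 1) := by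
  induction N with
  | zero => simp
  | succ N ih =>
    rw [show 2 * (N + 1) = 2 * N + 1 + 1 by ring]
    simp only [sum_range_succ, ih]
    abel

theorem tsum_two_mul {f : ℕ → (ZMod 2)⟦X⟧} (h : ∀ n, X ^ n ∣ f n) :
    ∑' n, f n = ∑' n, f (2 * n) + ∑' n, f (2 * n + 1) := by
  refine eq_of_forall_modX fun N ↦ ?_
  have h' : ∀ {a b : ℕ}, a ≤ b → X ^ a ∣ f b := fun hab ↦ (pow_dvd_pow X hab).trans (h _)
  rw [modX_tsum_of_le h (show N ≤ 2 * N by omega)]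
  simp only [map_add]
  rw [modX_tsum fun n ↦ h' (by omega), modX_tsum fun n ↦ h' (by omega), sum_range_two_mul]

/-- Gauss's theta series for triangular numbers. -/
theorem eta_pow_three {k : ℕ} (hk : 1 ≤ k) : eta k ^ 3 = ∑' n : ℕ, X ^ (k * (n + 1).choose 2) := by
  -- The progressions k and 3k modulo 4k make up the odd multiples of k, with product 1/E_k. As
  -- E_{4k} = E_k^4, the left side is E_k^3; the two sums on the right are the even and the odd n.
  have h := jacobi_triple_product (s := k) (t := 3 * k) hk (by omega)
  have h2 := qTprod_two_mul k (d := 2 * k) (by omega)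
  rw [show 2 * (2 * k) = 4 * k by ring, show k + 2 * k = 3 * k by ring] at h2
  have h1 := qTprod_odd_mul_eta hk
  rw [show k + 3 * k = 4 * k by ring, ← h2, ← eta, ← eta_pow_four hk] at h
  rw [tsum_two_mul fun n ↦ pow_dvd_pow X (by nlinarith [le_choose_two_succ n])]
  refine Eq.trans (by linear_combination -eta k ^ 3 * h1) (h.trans ?_)
  congr 1 <;> refine tsum_congr fun i ↦ ?_ <;> congr 1
  · rw [two_mul i, choose_two_succ, choose_two_add]
    have := two_mul_choose_two_succ i
    rw [choose_two_succ] at this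
    nlinarith
  · rw [show 2 * i + 1 + 1 = (i + 1) + (i + 1) by ring, choose_two_add (i + 1) (i + 1)]
    have := two_mul_choose_two_succ i
    nlinarith

/-- The theta series `∑ q^(k(3n²+2n))` over all integers `n`. -/
def theta (k : ℕ) : (ZMod 2)⟦X⟧ :=
  ∑' i : ℕ, X ^ (k * (3 * i ^ 2 + 2 * i)) + ∑' i : ℕ, X ^ (k * (3 * i ^ 2 + 4 * i + 1))

/-- The triple product with s = k, t = 5k involves the odd multiples of k not divisible by 3k. Their
product is E_{3k}/E_k, and the remaining factor is E_{6k} = E_{3k}². -/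
theorem theta_mul_eta {k : ℕ} (hk : 1 ≤ k) : theta k * eta k = eta (3 * k) ^ 3 := by
  have h := jacobi_triple_product (s := k) (t := 5 * k) hk (by omega)
  have h1 := qTprod_odd_mul_eta hk
  have h2 := qTprod_odd_mul_eta (k := 3 * k) (by omega)
  have h3 := qTprod_three_mul k (d := 2 * k) (by omega)
  rw [show 3 * (2 * k) = 6 * k by ring, show k + 2 * k = 3 * k by ring,
    show k + 2 * (2 * k) = 5 * k by ring] at h3
  have h4 := eta_sq (k := 3 * k) (by omega)
  rw [show 2 * (3 * k) = 6 * k by ring] at h2 h4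
  rw [show k + 5 * k = 6 * k by ring, ← eta, ← h4] at h
  have ht : theta k = qTprod k (6 * k) * qTprod (5 * k) (6 * k) * eta (3 * k) ^ 2 := by
    rw [h, theta]
    congr 1 <;> refine tsum_congr fun i ↦ ?_ <;> congr 1
    · have := two_mul_choose_two_succ i
      rw [choose_two_succ] at this
      nlinarith
    · have := two_mul_choose_two_succ i
      nlinarith
  rw [ht]
  rw [h3] at h1
  linear_combination eta (3 * k) ^ 3 * h1 -
    qTprod k (6 * k) * qTprod (5 * k) (6 * k) * eta (3 * k) ^ 2 * eta k * h2

theorem theta_one_pow_four : theta 1 ^ 4 = theta 4 := by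
  have h1 := congrArg (· ^ 4) (theta_mul_eta le_rfl)
  have h4 := theta_mul_eta (k := 4) (by norm_num)
  simp only [mul_pow] at h1
  rw [eta_pow_four le_rfl, ← pow_mul, mul_comm 3 4, pow_mul, eta_pow_four (by norm_num)] at h1
  exact mul_right_cancel₀ (eta_ne_zero (by norm_num)) (h1.trans h4.symm)

theorem sum_range_three_mul {M : Type*} [AddCommMonoid M] (g : ℕ → M) (N : ℕ) :
    ∑ n ∈ range (3 * N), g n =
      ∑ n ∈ range N, g (3 * n) + ∑ n ∈ range N, g (3 * n + 1) + ∑ n ∈ range N, g (3 * n + 2) := by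
  induction N with
  | zero => simp
  | succ N ih =>
    rw [show 3 * (N + 1) = 3 * N + 1 + 1 + 1 by ring]
    simp only [sum_range_succ, ih]
    abel

theorem tsum_three_mul {f : ℕ → (ZMod 2)⟦X⟧} (h : ∀ n, X ^ n ∣ f n) :
    ∑' n, f n = ∑' n, f (3 * n) + ∑' n, f (3 * n + 1) + ∑' n, f (3 * n + 2) := by
  refine eq_of_forall_modX fun N ↦ ?_
  have h' : ∀ {a b : ℕ}, a ≤ b → X ^ a ∣ f b := fun hab ↦ (pow_dvd_pow X hab).trans (h _)
  rw [modX_tsum_of_le h (show N ≤ 3 * N by omega)]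
  simp only [map_add]
  rw [modX_tsum fun n ↦ h' (by omega), modX_tsum fun n ↦ h' (by omega),
    modX_tsum fun n ↦ h' (by omega), sum_range_three_mul]

/-- The `3`-dissection of `∑ q^(n(n+1)/2)`. -/
theorem eta_one_pow_three : eta 1 ^ 3 = eta 3 + X * eta 9 ^ 3 := by
  rw [eta_pow_three le_rfl, eta_pow_three (by norm_num), eta_eq_tsum (by norm_num),
    tsum_three_mul fun n ↦ pow_dvd_pow X (by rw [one_mul]; exact le_choose_two_succ n),
    ← (summable_X_pow (e := fun n ↦ 9 * (n + 1).choose 2) fun n ↦ by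
      linarith [le_choose_two_succ n]).tsum_mul_left, add_right_comm]
  simp_rw [← pow_succ']
  congr 1
  -- The triangular numbers at n = 3i and 3i + 2 form the two halves of the pentagonal series of
  -- E_3; at n = 3i + 1 they are 9i(i+1)/2 + 1.
  · congr 1 <;> refine tsum_congr fun i ↦ ?_ <;> congr 1
    · have h1 := two_mul_choose_two_succ i
      have h2 := two_mul_choose_two_succ (3 * i)
      rw [choose_two_succ] at h1
      nlinarith
    · have h1 := two_mul_choose_two_succ i
      have h2 := two_mul_choose_two_succ (3 * i + 2)
      nlinarith
  · refine tsum_congr fun i ↦ ?_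
    congr 1
    have h1 := two_mul_choose_two_succ i
    have h2 := two_mul_choose_two_succ (3 * i + 1)
    nlinarith

/-- In the exponent 3n² + 2n, an even n = 2m gives 8 times the pentagonal number (3m² + m)/2, and an
odd n = 2m + 1 gives 4(3m² + 4m + 1) + 1. In the second half of `theta`, n = -(i + 1), so the parity
of i is reversed. -/
theorem theta_one : theta 1 = eta 8 + X * theta 4 := by
  have hs3 := summable_X_pow (e := fun i ↦ 4 * (3 * i ^ 2 + 2 * i)) fun i ↦ by nlinarith
  have hs4 := summable_X_pow (e := fun i ↦ 4 * (3 * i ^ 2 + 4 * i + 1)) fun i ↦ by nlinarith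
  have h1 := tsum_two_mul (f := fun i ↦ X ^ (1 * (3 * i ^ 2 + 2 * i)))
    fun i ↦ pow_dvd_pow X (by nlinarith)
  have h2 := tsum_two_mul (f := fun i ↦ X ^ (1 * (3 * i ^ 2 + 4 * i + 1)))
    fun i ↦ pow_dvd_pow X (by nlinarith)
  rw [theta, theta, h1, h2, eta_eq_tsum (by norm_num), mul_add, ← hs3.tsum_mul_left, ← hs4.tsum_mul_left]
  simp_rw [← pow_succ']
  have e1 : ∀ i : ℕ, 1 * (3 * (2 * i) ^ 2 + 2 * (2 * i)) = 8 * (3 * i.choose 2 + 2 * i) :=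
    fun i ↦ by
      have h1 := two_mul_choose_two_succ i
      rw [choose_two_succ] at h1
      nlinarith
  have e2 : ∀ i : ℕ, 1 * (3 * (2 * i + 1) ^ 2 + 4 * (2 * i + 1) + 1) =
      8 * (3 * (i + 1).choose 2 + (i + 1)) := fun i ↦ by
    have h1 := two_mul_choose_two_succ i
    nlinarith
  have e3 : ∀ i : ℕ, 1 * (3 * (2 * i + 1) ^ 2 + 2 * (2 * i + 1)) =
      4 * (3 * i ^ 2 + 4 * i + 1) + 1 := fun i ↦ by ring
  have e4 : ∀ i : ℕ, 1 * (3 * (2 * i) ^ 2 + 4 * (2 * i) + 1) =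
      4 * (3 * i ^ 2 + 2 * i) + 1 := fun i ↦ by ring
  simp only [e1, e2, e3, e4]
  ring

/-- This is θ = E_1^8 + qθ^4 multiplied by E_1^4, with θE_1 = E_3^3. It accounts for j_6. -/
theorem eta_one_mul_eta_three_pow_three :
    eta 1 ^ 3 * eta 3 ^ 3 = eta 1 ^ 12 + X * eta 3 ^ 12 := by
  have h1 := theta_mul_eta (k := 1) le_rfl
  have h2 := theta_one
  have h8 : eta 8 = eta 1 ^ 8 := by
    rw [show 8 = 4 * 2 by norm_num, pow_mul, eta_pow_four le_rfl, eta_sq (by norm_num)]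
  rw [← theta_one_pow_four, h8] at h2
  have h4 := congrArg (· ^ 4) h1
  simp only [mul_one] at h1 h4
  linear_combination -eta 1 ^ 3 * h1 + eta 1 ^ 4 * h2 + X * h4

/-! ### `q`-series identities over `ZMod 2` -/

theorem mul_inv_eq_one {a : (ZMod 2)⟦X⟧} (ha : constantCoeff a = 1) : a * a⁻¹ = 1 :=
  PowerSeries.mul_inv_cancel a (by rw [ha]; exact one_ne_zero)

theorem constantCoeff_one_sub_X_pow {s : ℕ} (hs : 1 ≤ s) :
    constantCoeff (1 - X ^ s : (ZMod 2)⟦X⟧) = 1 := by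
  rw [map_sub, map_one, map_pow, constantCoeff_X, zero_pow (by omega), sub_zero]

theorem inv_qProd {s : ℕ} (hs : 1 ≤ s) (d n : ℕ) :
    (qProd s d n)⁻¹ = (qProd s d (n + 1))⁻¹ * (1 - X ^ (s + d * n)) := by
  rw [qProd_succ, PowerSeries.mul_inv_rev, mul_right_comm, mul_comm _ (1 - _),
    mul_inv_eq_one (constantCoeff_one_sub_X_pow (by omega)), one_mul]

theorem inv_qProd_add {s : ℕ} (hs : 1 ≤ s) (d n : ℕ) :
    (qProd (s + d) d n)⁻¹ = (qProd s d (n + 1))⁻¹ * (1 - X ^ s) := by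
  rw [qProd_succ', PowerSeries.mul_inv_rev, mul_assoc, mul_comm _ (1 - _),
    mul_inv_eq_one (constantCoeff_one_sub_X_pow (by omega)), mul_one]

theorem inv_qProd_sq (n : ℕ) :
    (qProd 1 1 n)⁻¹ ^ 2 = (qProd 1 1 (n + 1))⁻¹ ^ 2 * (1 - X ^ (2 * n + 2)) := by
  rw [inv_qProd le_rfl, mul_pow, sq_one_sub]
  ring

theorem tsum_eq_tsum_add_of_telescoping {f g c : ℕ → (ZMod 2)⟦X⟧} (hg : ∀ n, X ^ n ∣ g n)
    (hc : ∀ n, X ^ n ∣ c n) (h : ∀ n, f n = g n + (c n - c (n + 1))) :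
    ∑' n, f n = ∑' n, g n + c 0 := by
  have h1 := summable_of_forall_X_pow_dvd hc
  have h2 : Summable fun n ↦ c (n + 1) := (summable_nat_add_iff 1).mpr h1
  rw [tsum_congr h, (summable_of_forall_X_pow_dvd hg).tsum_add (h1.sub h2), tsum_sub_succ hc]

theorem tsum_eq_tsum_add_tsum {f g h : ℕ → (ZMod 2)⟦X⟧} (hf : ∀ n, X ^ n ∣ f n)
    (hg : ∀ n, X ^ n ∣ g n) (hh : ∀ n, X ^ n ∣ h n) (h0 : f 0 = g 0)
    (hs : ∀ n, f (n + 1) = g (n + 1) + h n) : ∑' n, f n = ∑' n, g n + ∑' n, h n := by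
  have sg := summable_of_forall_X_pow_dvd hg
  rw [(summable_of_forall_X_pow_dvd hf).tsum_eq_zero_add, tsum_congr hs,
    ((summable_nat_add_iff 1).mpr sg).tsum_add (summable_of_forall_X_pow_dvd hh),
    sg.tsum_eq_zero_add, h0, add_assoc]

theorem tsum_const_mul {f : ℕ → (ZMod 2)⟦X⟧} (hf : ∀ n, X ^ n ∣ f n) (a : (ZMod 2)⟦X⟧) :
    ∑' n, a * f n = a * ∑' n, f n := (summable_of_forall_X_pow_dvd hf).tsum_mul_left a

theorem X_pow_dvd_X_pow_mul {m n : ℕ} (h : m ≤ n) (a : (ZMod 2)⟦X⟧) : X ^ m ∣ X ^ n * a :=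
  (pow_dvd_pow X h).mul_right a

theorem eq_qTprod_of_recurrence {F : ℕ → (ZMod 2)⟦X⟧} {a d : ℕ} (hd : 1 ≤ d)
    (hF : ∀ k, X ^ k ∣ F k - 1) (h : ∀ k, F k = F (k + 1) * (1 - X ^ (a + d * k))) :
    F 0 = qTprod a d := by
  have key : ∀ n, F 0 = F n * qProd a d n := fun n ↦ by
    induction n with
    | zero => simp
    | succ n ih => rw [qProd_succ, ih, h]; ring
  refine eq_of_forall_modX fun N ↦ ?_
  rw [key N, map_mul, modX_eq_iff.mpr (hF N), map_one, one_mul, modX_qProd hd (by nlinarith)]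

/-- Cauchy's identity `∑ q^(n²) / (q)_n² = 1 / (q)_∞`. -/
theorem tsum_X_pow_sq_mul_eta :
    (∑' n : ℕ, X ^ (n ^ 2) * (qProd 1 1 n)⁻¹ ^ 2) * eta 1 = 1 := by
  -- The deformed sum is 1/(q^(k+1);q)_∞: raising k strips one factor, and the sum tends to 1.
  set r : ℕ → ℕ → (ZMod 2)⟦X⟧ := fun k n ↦
    X ^ (n ^ 2 + k * n) * ((qProd 1 1 n)⁻¹ * (qProd (k + 1) 1 n)⁻¹) with hr
  have hdvd : ∀ k n, X ^ n ∣ r k n := fun k n ↦ X_pow_dvd_X_pow_mul (by nlinarith) _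
  have h0 : ∑' n : ℕ, X ^ (n ^ 2) * (qProd 1 1 n)⁻¹ ^ 2 = ∑' n, r 0 n :=
    tsum_congr fun n ↦ by rw [hr]; ring_nf
  rw [h0]
  refine mul_qTprod_eq_one_of_recurrence (F := fun k ↦ ∑' n, r k n) le_rfl (fun k ↦ ?_) fun k ↦ ?_
  · have : r k 0 = 1 := by simp [hr]
    rw [← this]
    exact tsum_sub_zeroth_dvd (hdvd k) fun n ↦ X_pow_dvd_X_pow_mul (by nlinarith) _
  -- The general term is q^(n²+kn)/((q)_{n-1} (q^(k+2);q)_{n-1}), with 1/(q)_{-1} read as 0; hence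
  -- there is no boundary term.
  · set c : ℕ → (ZMod 2)⟦X⟧ := fun n ↦ n.casesOn 0
      fun n ↦ X ^ ((n + 1) ^ 2 + k * (n + 1)) * ((qProd 1 1 n)⁻¹ * (qProd (k + 2) 1 n)⁻¹) with hc
    have hcd : ∀ n, X ^ n ∣ c n := fun n ↦ by
      rcases n with _ | n
      · simp
      · exact X_pow_dvd_X_pow_mul (by nlinarith) _
    rw [mul_comm, ← tsum_const_mul (hdvd k),
      tsum_eq_tsum_add_of_telescoping (g := r (k + 1)) (hdvd _) hcd]
    · exact add_zero _
    rintro (_ | n)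
    · simp [hr, hc]
      ring
    · simp only [hr, hc]
      rw [inv_qProd (s := 1) le_rfl 1 n,
        inv_qProd (s := k + 2) (by omega) 1 n]
      have h1 := inv_qProd_add (s := k + 1) (by omega) 1 n
      rw [inv_qProd (by omega)] at h1
      simp only [show k + 1 + 1 = k + 2 by ring] at h1 ⊢
      linear_combination (-X ^ ((n + 1) ^ 2 + k * (n + 1)) * (qProd 1 1 (n + 1))⁻¹) * h1

/-- The third order mock theta function `ν` is congruent to a theta series. -/
theorem tsum_X_pow_mul_inv_eq_theta :
    ∑' n : ℕ, X ^ (n ^ 2 + n) * (qProd 1 2 (n + 1))⁻¹ = theta 1 := by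
  set g : ℕ → ℕ → (ZMod 2)⟦X⟧ := fun k n ↦
    X ^ (n ^ 2 + n + 4 * k * n) * (qProd (2 * k + 1) 2 (n + 1))⁻¹ with hg
  have hdvd : ∀ k n, X ^ n ∣ g k n := fun k n ↦ X_pow_dvd_X_pow_mul (by nlinarith) _
  -- On iteration the factors q^(6i+5), i < k, multiply to q^(3k²+2k), and the two terms of 1 +
  -- q^(2k+1) yield the two halves of θ.
  have hrec : ∀ k, ∑' n, g k n = (1 + X ^ (2 * k + 1)) + X ^ (6 * k + 5) * ∑' n, g (k + 1) n := by
    intro k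
    set c : ℕ → (ZMod 2)⟦X⟧ := fun n ↦
      X ^ ((n + 1) ^ 2 + (n + 1) + 4 * k * (n + 1)) * (qProd (2 * k + 1) 2 (n + 1))⁻¹ with hc
    have hcd : ∀ n, X ^ n ∣ c n := fun n ↦ X_pow_dvd_X_pow_mul (by nlinarith) _
    rw [(summable_of_forall_X_pow_dvd (hdvd k)).tsum_eq_zero_add, ← tsum_const_mul (hdvd (k + 1)),
      tsum_eq_tsum_add_of_telescoping (g := fun n ↦ X ^ (6 * k + 5) * g (k + 1) n)
        (fun n ↦ (hdvd _ n).mul_left _) hcd]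
    · have h1 := mul_inv_eq_one (constantCoeff_one_sub_X_pow (s := 2 * k + 1) (by omega))
      simp only [hg, hc, qProd_succ, qProd_zero]
      simp only [mul_zero, add_zero, one_mul, zero_add]
      linear_combination (1 + X ^ (2 * k + 1)) * h1 +
        X ^ (4 * k + 2) * (1 - X ^ (2 * k + 1))⁻¹ * two_eq_zero
    · intro n
      simp only [hg, hc]
      have h1 := inv_qProd_add (s := 2 * k + 1) (by omega) 2 (n + 1)
      rw [show 2 * (k + 1) + 1 = 2 * k + 1 + 2 by ring, h1, inv_qProd (by omega) 2 (n + 1)]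
      linear_combination (X ^ (n ^ 2 + 5 * n + 4 * k * n + 8 * k + 6) *
        (qProd (2 * k + 1) 2 (n + 1 + 1))⁻¹) * two_eq_zero
  have h0 : ∑' n : ℕ, X ^ (n ^ 2 + n) * (qProd 1 2 (n + 1))⁻¹ = ∑' n, g 0 n :=
    tsum_congr fun n ↦ by simp [hg]
  have hprod : ∀ k : ℕ, ∏ i ∈ range k, (X : (ZMod 2)⟦X⟧) ^ (6 * i + 5) = X ^ (3 * k ^ 2 + 2 * k) := by
    intro k
    induction k with
    | zero => simp
    | succ k ih => rw [prod_range_succ, ih]; ring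
  rw [h0, ← tsum_of_recurrence (F := fun k ↦ ∑' n, g k n) (fun k ↦ dvd_pow_self X (by omega)) hrec,
    theta, ← (summable_X_pow fun i ↦ by nlinarith).tsum_add (summable_X_pow fun i ↦ by nlinarith)]
  refine tsum_congr fun k ↦ ?_
  rw [hprod]
  ring

theorem tsum_sq {f : ℕ → (ZMod 2)⟦X⟧} (hf : ∀ n, X ^ n ∣ f n) :
    ∑' n, f n ^ 2 = (∑' n, f n) ^ 2 := by
  refine eq_of_forall_modX fun N ↦ ?_
  have hf2 : ∀ n, X ^ n ∣ f n ^ 2 := fun n ↦ (hf n).trans (dvd_pow_self _ two_ne_zero)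
  have hsq : ∑ n ∈ range N, f n ^ 2 = (∑ n ∈ range N, f n) ^ 2 := by
    induction N with
    | zero => simp
    | succ N ih =>
      rw [sum_range_succ, sum_range_succ, ih]
      linear_combination -(∑ n ∈ range N, f n) * f N * two_eq_zero
  rw [map_pow, modX_tsum hf, modX_tsum hf2, ← map_sum, ← map_sum, hsq, map_pow]

/-- A case of the Rogers–Fine identity. -/
theorem tsum_X_pow_mul_inv_eq_theta_sq :
    ∑' m : ℕ, X ^ m * (qProd 1 2 (m + 1))⁻¹ = theta 1 ^ 2 := by
  set f : ℕ → ℕ → (ZMod 2)⟦X⟧ := fun k m ↦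
    X ^ ((2 * k + 1) * m) * (qProd (2 * k + 1) 2 (m + 1))⁻¹ with hf
  have hdvd : ∀ k m, X ^ m ∣ f k m := fun k m ↦ X_pow_dvd_X_pow_mul (by nlinarith) _
  set w : ℕ → (ZMod 2)⟦X⟧ := fun k ↦ (1 - X ^ (1 + 2 * k))⁻¹ with hw
  have hrec : ∀ k, ∑' m, f k m = w k ^ 2 + w k ^ 2 * X ^ (4 * k + 4) * ∑' m, f (k + 1) m := by
    intro k
    set c : ℕ → (ZMod 2)⟦X⟧ := fun m ↦
      X ^ ((2 * k + 1) * m) * (qProd (2 * k + 3) 2 m)⁻¹ with hc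
    have hcd : ∀ n, X ^ n ∣ c n := fun n ↦ X_pow_dvd_X_pow_mul (by nlinarith) _
    have h1 : (1 - X ^ (1 + 2 * k)) ^ 2 * ∑' m, f k m =
        X ^ (4 * k + 4) * ∑' m, f (k + 1) m + 1 := by
      have hc0 : c 0 = 1 := by simp [hc]
      rw [← tsum_const_mul (hdvd k), ← tsum_const_mul (hdvd (k + 1))]
      refine (tsum_eq_tsum_add_of_telescoping (c := c) (fun n ↦ (hdvd _ n).mul_left _) hcd
        fun m ↦ ?_).trans (by rw [hc0])
      have h2 := inv_qProd_add (s := 2 * k + 1) (by omega) 2 m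
      rw [show 2 * k + 1 + 2 = 2 * k + 3 by ring, inv_qProd (by omega)] at h2
      simp only [hf, hc]
      rw [inv_qProd (s := 2 * k + 3) (by omega) 2 m, show 2 * (k + 1) + 1 = 2 * k + 3 by ring]
      linear_combination -(1 - X ^ (2 * k + 1)) * X ^ ((2 * k + 1) * m) * h2
    have h3 : (1 - X ^ (1 + 2 * k)) * w k = 1 :=
      mul_inv_eq_one (constantCoeff_one_sub_X_pow (by omega))
    linear_combination w k ^ 2 * h1 -
      ((1 - X ^ (1 + 2 * k)) * w k + 1) * (∑' m, f k m) * h3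
  have h0 : ∑' m : ℕ, X ^ m * (qProd 1 2 (m + 1))⁻¹ = ∑' m, f 0 m :=
    tsum_congr fun n ↦ by simp [hf]
  -- Every term of the iterated recurrence is a square, so by Frobenius the sum is the square of the
  -- series evaluated in `tsum_X_pow_mul_inv_eq_theta`.
  have hprod : ∀ k : ℕ, ∏ i ∈ range k, (w i ^ 2 * X ^ (4 * i + 4)) =
      (X ^ (k ^ 2 + k) * (qProd 1 2 k)⁻¹) ^ 2 := by
    intro k
    induction k with
    | zero => simp
    | succ k ih =>
      rw [prod_range_succ, ih, qProd_succ, PowerSeries.mul_inv_rev]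
      ring
  rw [h0, ← tsum_of_recurrence (F := fun k ↦ ∑' m, f k m)
    (fun k ↦ (dvd_pow_self X (by omega)).mul_left _) hrec, ← tsum_X_pow_mul_inv_eq_theta,
    ← tsum_sq fun n ↦ X_pow_dvd_X_pow_mul (by nlinarith) _]
  refine tsum_congr fun k ↦ ?_
  rw [hprod, qProd_succ 1 2 k, PowerSeries.mul_inv_rev]
  ring

/-- The sum behind ψ_6. Expanding 1/(1 - q^(2n+1)) geometrically in k leaves inner sums which
Euler's identity evaluates as (q^(2k+3);q²) = (q;q²)/(q;q²)_{k+1}; the Rogers–Fine sum remains. -/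
theorem tsum_mul_eta_eq_theta_sq :
    (∑' n : ℕ, X ^ (n ^ 2 + 2 * n) * ((qProd 1 1 n)⁻¹ ^ 2 * (1 - X ^ (2 * n + 1))⁻¹)) * eta 1 =
      theta 1 ^ 2 := by
  set a : ℕ → ℕ → (ZMod 2)⟦X⟧ := fun k n ↦
    X ^ (n ^ 2 + 2 * n + 2 * k * n) * (qProd 1 1 n)⁻¹ ^ 2 with ha
  set s : ℕ → ℕ → (ZMod 2)⟦X⟧ := fun k n ↦ a k n * (1 - X ^ (2 * n + 1))⁻¹ with hs
  have had : ∀ k n, X ^ n ∣ a k n := fun k n ↦ X_pow_dvd_X_pow_mul (by nlinarith) _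
  have hsd : ∀ k n, X ^ n ∣ s k n := fun k n ↦ (had k n).mul_right _
  have hA : ∀ k, ∑' n, a k n = qTprod (3 + 2 * k) 2 := by
    intro k
    refine eq_qTprod_of_recurrence (F := fun j ↦ ∑' n, a (k + j) n) (by norm_num)
      (fun j ↦ ?_) fun j ↦ ?_
    · have : a (k + j) 0 = 1 := by simp [ha]
      rw [← this]
      exact tsum_sub_zeroth_dvd (had _) fun n ↦ X_pow_dvd_X_pow_mul (by nlinarith) _
    · rw [← add_eq_sub', mul_add, mul_one, mul_comm, ← tsum_const_mul (had _)]
      refine tsum_eq_tsum_add_tsum (had _) (had _) (fun n ↦ (had _ n).mul_left _) (by simp [ha])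
        fun n ↦ ?_
      simp only [ha]
      rw [inv_qProd_sq n]
      ring
  have hS : ∀ k, ∑' n, s k n = ∑' n, a k n + X * ∑' n, s (k + 1) n := by
    intro k
    rw [← tsum_const_mul (hsd _), ← (summable_of_forall_X_pow_dvd (had k)).tsum_add
      (summable_of_forall_X_pow_dvd fun n ↦ (hsd _ n).mul_left _)]
    refine tsum_congr fun n ↦ ?_
    simp only [hs, ha]
    linear_combination (X ^ (n ^ 2 + 2 * n + 2 * k * n) * (qProd 1 1 n)⁻¹ ^ 2) *
      mul_inv_eq_one (constantCoeff_one_sub_X_pow (s := 2 * n + 1) (by omega))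
  have h0 : ∑' n : ℕ, X ^ (n ^ 2 + 2 * n) * ((qProd 1 1 n)⁻¹ ^ 2 * (1 - X ^ (2 * n + 1))⁻¹) =
      ∑' n, s 0 n :=
    tsum_congr fun n ↦ by simp [hs, ha, mul_assoc]
  rw [h0, ← tsum_of_recurrence (F := fun k ↦ ∑' m, s k m) (fun _ ↦ dvd_rfl) hS,
    ← tsum_X_pow_mul_inv_eq_theta_sq]
  have h1 : ∀ k, (∑' n, a k n) * ∏ _i ∈ range k, X =
      qTprod 1 2 * (X ^ k * (qProd 1 2 (k + 1))⁻¹) := fun k ↦ by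
    have h2 := mul_inv_eq_one (constantCoeff_qProd (s := 1) le_rfl 2 (k + 1))
    rw [hA, prod_const, card_range, qTprod_eq_mul 1 (d := 2) (by norm_num) (k + 1),
      show 1 + 2 * (k + 1) = 3 + 2 * k by ring]
    linear_combination -qTprod (3 + 2 * k) 2 * X ^ k * h2
  rw [tsum_congr h1, tsum_const_mul fun n ↦ X_pow_dvd_X_pow_mul le_rfl _]
  linear_combination (∑' m : ℕ, X ^ m * (qProd 1 2 (m + 1))⁻¹) * qTprod_odd_mul_eta le_rfl

/-- Euler's expansion of `1 / (q^s, q²)_∞`. -/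
theorem tsum_X_pow_mul_inv_sq_mul_qTprod {s : ℕ} (hs : 1 ≤ s) :
    (∑' m : ℕ, X ^ (s * m) * (qProd 1 1 m)⁻¹ ^ 2) * qTprod s 2 = 1 := by
  set f : ℕ → ℕ → (ZMod 2)⟦X⟧ := fun j m ↦
    X ^ ((s + 2 * j) * m) * (qProd 1 1 m)⁻¹ ^ 2 with hf
  have hdvd : ∀ j m, X ^ m ∣ f j m := fun j m ↦ X_pow_dvd_X_pow_mul (by nlinarith) _
  refine mul_qTprod_eq_one_of_recurrence (F := fun j ↦ ∑' m, f j m) (by norm_num)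
    (fun j ↦ ?_) fun j ↦ ?_
  · have : f j 0 = 1 := by simp [hf]
    rw [← this]
    exact tsum_sub_zeroth_dvd (hdvd j) fun n ↦ X_pow_dvd_X_pow_mul (by nlinarith) _
  · have h := tsum_eq_tsum_add_tsum (f := f j) (g := f (j + 1))
      (h := fun m ↦ X ^ (s + 2 * j) * f j m) (hdvd _) (hdvd _) (fun m ↦ (hdvd _ m).mul_left _)
      (by simp [hf]) fun m ↦ by
        simp only [hf]
        rw [inv_qProd_sq m]
        ring
    rw [tsum_const_mul (hdvd j)] at h
    linear_combination h

/-- A case of the `q`-binomial theorem. -/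
theorem tsum_X_pow_mul_qProd_mul_qTprod {k : ℕ} (hk : 1 ≤ k) :
    (∑' n : ℕ, X ^ (2 * k * n) * (qProd 1 2 n * (qProd 1 1 n)⁻¹ ^ 2)) * qTprod (2 * k) 2 =
      qTprod (2 * k + 1) 2 := by
  set f : ℕ → ℕ → (ZMod 2)⟦X⟧ := fun j n ↦
    X ^ (2 * (k + j) * n) * (qProd 1 2 n * (qProd 1 1 n)⁻¹ ^ 2) with hf
  have hdvd : ∀ j m, X ^ m ∣ f j m := fun j m ↦ X_pow_dvd_X_pow_mul (by nlinarith) _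
  refine mul_qTprod_of_recurrence (F := fun j ↦ ∑' m, f j m) (by norm_num) (by norm_num)
    (fun j ↦ ?_) fun j ↦ ?_
  · have : f j 0 = 1 := by simp [hf]
    rw [← this]
    exact tsum_sub_zeroth_dvd (hdvd j) fun n ↦ X_pow_dvd_X_pow_mul (by nlinarith) _
  · have h := tsum_eq_tsum_add_tsum (f := f j) (g := f (j + 1))
      (h := fun n ↦ X ^ (2 * k + 2 * j) * f j n - X ^ (2 * k + 2 * j + 1) * f (j + 1) n)
      (hdvd _) (hdvd _)
      (fun m ↦ dvd_sub ((hdvd _ m).mul_left _) ((hdvd _ m).mul_left _)) (by simp [hf]) fun n ↦ by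
        simp only [hf]
        rw [inv_qProd_sq n, qProd_succ 1 2 n]
        ring
    rw [((summable_of_forall_X_pow_dvd fun m ↦ (hdvd j m).mul_left _)).tsum_sub
      (summable_of_forall_X_pow_dvd fun m ↦ (hdvd (j + 1) m).mul_left _),
      tsum_const_mul (hdvd j), tsum_const_mul (hdvd (j + 1))] at h
    linear_combination h

/-- A case of Heine's transformation. -/
theorem tsum_sq_mul_eta_pow_four :
    (∑' n : ℕ, X ^ (2 * n) * (qProd 1 2 n ^ 2 * (qProd 1 1 n)⁻¹ ^ 2)) * eta 1 ^ 4 =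
      theta 1 ^ 2 := by
  -- One factor (q;q²)_n, times E_1, is 1/(q^(2n+1);q²), which Euler expands in m. In the resulting
  -- double sum the columns are evaluated by the q-binomial theorem, leaving the Rogers–Fine sum.
  set h : ℕ → ℕ → (ZMod 2)⟦X⟧ := fun n m ↦
    X ^ (2 * n + (2 * n + 1) * m) * (qProd 1 2 n * (qProd 1 1 n)⁻¹ ^ 2 * (qProd 1 1 m)⁻¹ ^ 2) with hh
  have hO := qTprod_odd_mul_eta (k := 1) le_rfl
  have hrow : ∀ n, ∑' m, h n m =
      eta 1 * (X ^ (2 * n) * (qProd 1 2 n ^ 2 * (qProd 1 1 n)⁻¹ ^ 2)) := fun n ↦ by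
    have h1 : ∑' m, h n m = X ^ (2 * n) * (qProd 1 2 n * (qProd 1 1 n)⁻¹ ^ 2) *
        ∑' m : ℕ, X ^ ((2 * n + 1) * m) * (qProd 1 1 m)⁻¹ ^ 2 := by
      rw [← tsum_const_mul fun m ↦ X_pow_dvd_X_pow_mul (by nlinarith) _]
      refine tsum_congr fun m ↦ ?_
      simp only [hh]
      ring
    have h2 := tsum_X_pow_mul_inv_sq_mul_qTprod (s := 2 * n + 1) (by omega)
    have h3 := qTprod_eq_mul 1 (d := 2) (by norm_num) n
    rw [show 1 + 2 * n = 2 * n + 1 by ring] at h3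
    rw [mul_one, h3] at hO
    rw [h1]
    generalize ∑' m : ℕ, X ^ ((2 * n + 1) * m) * (qProd 1 1 m)⁻¹ ^ 2 = Y at *
    linear_combination X ^ (2 * n) * (qProd 1 2 n * (qProd 1 1 n)⁻¹ ^ 2) *
      (qProd 1 2 n * eta 1 * h2 - Y * hO)
  have hcol : ∀ m, eta 1 ^ 3 * ∑' n, h n m = X ^ m * (qProd 1 2 (m + 1))⁻¹ := fun m ↦ by
    have h1 : ∑' n, h n m = X ^ m * (qProd 1 1 m)⁻¹ ^ 2 *
        ∑' n : ℕ, X ^ (2 * (m + 1) * n) * (qProd 1 2 n * (qProd 1 1 n)⁻¹ ^ 2) := by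
      rw [← tsum_const_mul fun n ↦ X_pow_dvd_X_pow_mul (by nlinarith) _]
      refine tsum_congr fun n ↦ ?_
      simp only [hh]
      ring
    have h2 := tsum_X_pow_mul_qProd_mul_qTprod (k := m + 1) (by omega)
    have h3 := qTprod_eq_mul 1 (d := 2) (by norm_num) (m + 1)
    have h4 : eta 1 ^ 2 = qProd 1 1 m ^ 2 * qTprod (2 * (m + 1)) 2 := by
      rw [eta_sq le_rfl, qProd_sq, show 2 * (m + 1) = 2 * 1 + 2 * 1 * m by ring]
      exact qTprod_eq_mul _ (by norm_num) m
    rw [show 1 + 2 * (m + 1) = 2 * (m + 1) + 1 by ring] at h3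
    rw [mul_one, h3] at hO
    have h5 := mul_inv_eq_one (constantCoeff_qProd (s := 1) le_rfl 1 m)
    have h6 := mul_inv_eq_one (constantCoeff_qProd (s := 1) le_rfl 2 (m + 1))
    rw [h1]
    generalize ∑' n : ℕ, X ^ (2 * (m + 1) * n) * (qProd 1 2 n * (qProd 1 1 n)⁻¹ ^ 2) = Y at *
    generalize (qProd 1 1 m)⁻¹ = d at *
    generalize (qProd 1 2 (m + 1))⁻¹ = i at *
    generalize qProd 1 1 m = D at *
    generalize qProd 1 2 (m + 1) = P at *
    linear_combination X ^ m * (eta 1 * d ^ 2 * Y * h4 + eta 1 * D ^ 2 * d ^ 2 * h2 +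
      eta 1 * qTprod (2 * (m + 1) + 1) 2 * (D * d + 1) * h5 -
      eta 1 * qTprod (2 * (m + 1) + 1) 2 * h6 + i * hO)
  have hsum : Summable (Function.uncurry h) :=
    summable_prod_of_forall_X_pow_dvd fun p ↦ X_pow_dvd_X_pow_mul (by nlinarith) _
  have hcomm := hsum.tsum_comm'
    (fun n ↦ summable_of_forall_X_pow_dvd fun m ↦ X_pow_dvd_X_pow_mul (by nlinarith) _)
    (fun m ↦ summable_of_forall_X_pow_dvd fun n ↦ X_pow_dvd_X_pow_mul (by nlinarith) _)
  rw [tsum_congr hrow, tsum_const_mul fun n ↦ X_pow_dvd_X_pow_mul (by omega) _] at hcomm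
  rw [← tsum_X_pow_mul_inv_eq_theta_sq, ← tsum_congr hcol,
    tsum_const_mul fun m ↦ X_pow_dvd_tsum fun n ↦ X_pow_dvd_X_pow_mul (by nlinarith) _, hcomm]
  ring

/-! ### Reduction modulo `2` -/

/-- Coefficientwise reduction modulo `2`. -/
def red : ℤ⟦X⟧ →+* (ZMod 2)⟦X⟧ := PowerSeries.map (Int.castRingHom (ZMod 2))

@[simp] theorem coeff_red (n : ℕ) (f : ℤ⟦X⟧) : coeff n (red f) = ((coeff n f : ℤ) : ZMod 2) := by
  simp [red]

@[simp] theorem red_X : red X = X := by simp [red]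

theorem constantCoeff_red {f : ℤ⟦X⟧} (h : constantCoeff f = 1) : constantCoeff (red f) = 1 := by
  rw [← coeff_zero_eq_constantCoeff_apply, coeff_red, coeff_zero_eq_constantCoeff_apply, h,
    Int.cast_one]

theorem continuous_red : Continuous red := by
  rw [continuous_iff_continuousAt]
  intro f
  rw [ContinuousAt, WithPiTopology.tendsto_iff_coeff_tendsto]
  intro d
  simp only [coeff_red]
  exact ((continuous_of_discreteTopology (f := fun a : ℤ ↦ (a : ZMod 2))).comp
    (WithPiTopology.continuous_coeff ℤ d)).tendsto f

theorem red_neg_one : red (-1) = 1 := by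
  rw [map_neg, map_one]
  linear_combination -two_eq_zero

theorem red_frac (a : ℤ⟦X⟧) {b : ℤ⟦X⟧} (hb : constantCoeff b = 1) :
    red (frac a b) = red a * (red b)⁻¹ := by
  have h := congrArg red (frac_mul_cancel a hb)
  rw [map_mul] at h
  exact (eq_mul_inv_iff_mul_eq (by rw [constantCoeff_red hb]; exact one_ne_zero)).mpr h

theorem red_tsum {f : ℕ → ℤ⟦X⟧} (hf : Summable f) : red (∑' n, f n) = ∑' n, red (f n) :=
  hf.map_tsum red continuous_red

theorem red_qInf {k : ℕ} (hk : 1 ≤ k) : red (qInf k) = eta k := by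
  rw [qInf, (multipliable_qInf hk).map_tprod red continuous_red, eta, qTprod]
  refine tprod_congr fun n ↦ ?_
  rw [map_sub, map_one, map_pow, map_pow, red_X]
  ring

theorem red_qPoch_X_X_sq (n : ℕ) : red (qPoch X (X ^ 2) n) = qProd 1 2 n := by
  rw [qPoch, map_prod, qProd]
  refine prod_congr rfl fun k _ ↦ ?_
  rw [map_sub, map_one, map_mul, map_pow, map_pow, red_X]
  ring

theorem red_qPoch_neg_X (n : ℕ) : red (qPoch (-X) X n) = qProd 1 1 n := by
  rw [qPoch, map_prod, qProd]
  refine prod_congr rfl fun k _ ↦ ?_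
  rw [map_sub, map_one, map_mul, map_pow, ← neg_one_mul (X : ℤ⟦X⟧), map_mul, red_neg_one, red_X]
  ring

theorem red_qPoch_neg_X_sq (n : ℕ) : red (qPoch (-X ^ 2) (X ^ 2) n) = qProd 1 1 n ^ 2 := by
  rw [qPoch, map_prod, qProd_sq, qProd]
  refine prod_congr rfl fun k _ ↦ ?_
  rw [map_sub, map_one, map_mul, map_pow, ← neg_one_mul ((X : ℤ⟦X⟧) ^ 2), map_mul, red_neg_one,
    map_pow, red_X]
  ring

theorem qProd_one_two_mul (n : ℕ) : qProd 1 1 (2 * n) = qProd 1 2 n * qProd 1 1 n ^ 2 := by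
  rw [qProd_two_mul, qProd_sq]

theorem inv_sq_inv {a : (ZMod 2)⟦X⟧} : (a ^ 2)⁻¹ = a⁻¹ ^ 2 := by
  rw [sq, PowerSeries.mul_inv_rev, sq]

/-! ### The mock theta functions modulo `2` -/

theorem red_f3 : red f3 = ∑' n : ℕ, X ^ (n ^ 2) * (qProd 1 1 n)⁻¹ ^ 2 := by
  rw [f3, red_tsum summable_f3]
  refine tsum_congr fun n ↦ ?_
  rw [red_frac _ (by rw [map_pow, constantCoeff_qPoch _ (by simp), one_pow]), map_pow, map_pow,
    red_X, red_qPoch_neg_X, inv_sq_inv]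

theorem red_phi3 : red phi3 = red f3 := by
  rw [red_f3, phi3, red_tsum summable_phi3]
  refine tsum_congr fun n ↦ ?_
  rw [red_frac _ (constantCoeff_qPoch _ (by simp) _), map_pow, red_X, red_qPoch_neg_X_sq,
    inv_sq_inv]

/-- Modulo 2, (-q;q)_{2n} is (q;q²)_n (q)_n², and its first factor cancels the numerator. -/
theorem red_phi6 : red phi6 = red f3 := by
  rw [red_f3, phi6, red_tsum summable_phi6]
  refine tsum_congr fun n ↦ ?_
  have h := mul_inv_eq_one (constantCoeff_qProd le_rfl 2 n)
  rw [red_frac _ (constantCoeff_qPoch _ (by simp) _), red_qPoch_neg_X, qProd_one_two_mul,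
    PowerSeries.mul_inv_rev, inv_sq_inv]
  simp only [map_mul, map_pow, red_neg_one, red_X, red_qPoch_X_X_sq, one_pow]
  linear_combination X ^ n ^ 2 * (qProd 1 1 n)⁻¹ ^ 2 * h

theorem red_f3_mul_eta : red f3 * eta 1 = 1 := by
  rw [red_f3, tsum_X_pow_sq_mul_eta]

theorem red_psi6 : red psi6 * eta 1 = X * theta 1 ^ 2 := by
  rw [psi6, red_tsum summable_psi6, ← tsum_mul_eta_eq_theta_sq, ← mul_assoc,
    ← tsum_const_mul fun n ↦ X_pow_dvd_X_pow_mul (by nlinarith) _]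
  congr 1
  refine tsum_congr fun n ↦ ?_
  have h := mul_inv_eq_one (constantCoeff_qProd le_rfl 2 n)
  have hD : qProd 1 1 (2 * n + 1) = qProd 1 2 n * qProd 1 1 n ^ 2 * (1 - X ^ (2 * n + 1)) := by
    rw [qProd_succ, qProd_one_two_mul, one_mul, add_comm 1 (2 * n)]
  rw [red_frac _ (constantCoeff_qPoch _ (by simp) _), red_qPoch_neg_X, hD,
    PowerSeries.mul_inv_rev, PowerSeries.mul_inv_rev, inv_sq_inv]
  simp only [map_mul, map_pow, red_neg_one, red_X, red_qPoch_X_X_sq, one_pow]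
  linear_combination X ^ (n + 1) ^ 2 * (qProd 1 1 n)⁻¹ ^ 2 * (1 - X ^ (2 * n + 1))⁻¹ * h

/-- The Heine sum is the termwise square of λ_6, so it determines λ_6², and square roots are unique
in a domain of characteristic 2. -/
theorem red_lambda6 : red lambda6 * eta 1 ^ 2 = theta 1 := by
  have h := tsum_sq_mul_eta_pow_four
  have h1 : red lambda6 = ∑' n : ℕ, X ^ n * (qProd 1 2 n * (qProd 1 1 n)⁻¹) := by
    rw [lambda6, red_tsum summable_lambda6]
    refine tsum_congr fun n ↦ ?_
    rw [red_frac _ (constantCoeff_qPoch _ (by simp) _), red_qPoch_neg_X]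
    simp only [map_mul, map_pow, red_neg_one, red_X, red_qPoch_X_X_sq, one_pow]
    ring
  have h2 : ∑' n : ℕ, X ^ (2 * n) * (qProd 1 2 n ^ 2 * (qProd 1 1 n)⁻¹ ^ 2) = red lambda6 ^ 2 := by
    rw [h1, ← tsum_sq fun n ↦ X_pow_dvd_X_pow_mul le_rfl _]
    refine tsum_congr fun n ↦ ?_
    ring
  rw [h2] at h
  refine sub_eq_zero.mp (pow_eq_zero_iff two_ne_zero |>.mp ?_)
  linear_combination h + (theta 1 ^ 2 - red lambda6 * eta 1 ^ 2 * theta 1) * two_eq_zero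

/-- With c_n = (q;q²)_n/(q)_n the summand is c_n + c_{n+1}. As c_0 = 1, the partial sums are c_N,
which tend to (q;q²)/E_1 = 1/E_1². -/
theorem red_twoMu6 : red twoMu6 * eta 1 ^ 2 = 1 := by
  set c : ℕ → (ZMod 2)⟦X⟧ := fun n ↦ qProd 1 2 n * (qProd 1 1 n)⁻¹ with hc
  set f : ℕ → (ZMod 2)⟦X⟧ := fun n ↦
    X ^ (n + 1) * ((1 + X ^ n) * qProd 1 2 n * (qProd 1 1 (n + 1))⁻¹) with hf
  have hfc : ∀ n, f n = c n + c (n + 1) := fun n ↦ by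
    simp only [hf, hc]
    rw [inv_qProd le_rfl 1 n, qProd_succ 1 2 n]
    linear_combination (X ^ (n + 1) + X ^ (2 * n + 1) - 1) * qProd 1 2 n *
      (qProd 1 1 (n + 1))⁻¹ * two_eq_zero
  have hsum : ∀ N, 1 + ∑ n ∈ range N, f n = c N := fun N ↦ by
    induction N with
    | zero => simp [hc]
    | succ N ih =>
      rw [sum_range_succ, ← add_assoc, ih, hfc]
      linear_combination c N * two_eq_zero
  have hred : red twoMu6 = 1 + ∑' n, f n := by
    rw [twoMu6, map_add, map_one, red_tsum summable_twoMu6]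
    congr 1
    refine tsum_congr fun n ↦ ?_
    rw [red_frac _ (constantCoeff_qPoch _ (by simp) _), red_qPoch_neg_X]
    simp only [map_mul, map_pow, map_add, map_one, red_neg_one, red_X, red_qPoch_X_X_sq, one_pow]
    ring
  refine eq_of_forall_modX fun N ↦ ?_
  have h1 := congrArg (modX N) (mul_inv_eq_one (constantCoeff_qProd le_rfl 1 N))
  have h2 := congrArg (modX N) (qTprod_odd_mul_eta (k := 1) le_rfl)
  have h3 := congrArg (modX N) (hsum N)
  rw [map_mul, modX_qProd le_rfl (by omega), map_one] at h1
  rw [map_mul, mul_one, map_one] at h2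
  rw [map_add, map_sum] at h3
  rw [hred, map_mul, map_add, modX_tsum fun n ↦ X_pow_dvd_X_pow_mul (by omega) _, h3, map_mul,
    modX_qProd (by norm_num) (by omega), map_pow, map_one]
  linear_combination h2 + modX N (qTprod 1 2) * modX N (eta 1) * h1

/-- The generating function of the partition numbers modulo `2`. -/
theorem mk_card_partition_mul_eta :
    PowerSeries.mk (fun n ↦ (Fintype.card (Nat.Partition n) : ZMod 2)) * eta 1 = 1 := by
  have h := Nat.Partition.hasProd_powerSeriesMk_card_restricted (ZMod 2) (fun _ ↦ True)
  have hcard : ∀ n, (Nat.Partition.restricted n fun _ ↦ True).card =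
      Fintype.card (Nat.Partition n) := fun n ↦ by
    simp [Nat.Partition.restricted]
  simp only [hcard, if_true] at h
  have h1 := (h.mul (multipliable_qTprod 1 le_rfl).hasProd).tprod_eq
  rw [← qTprod, ← eta] at h1
  refine h1.symm.trans ((tprod_congr fun i ↦ ?_).trans tprod_one)
  simp_rw [pow_mul]
  rw [one_mul, add_comm 1 i]
  exact WithPiTopology.tsum_pow_mul_one_sub_of_constantCoeff_eq_zero (by simp)

/-! ### The Hauptmoduln modulo `2` -/

theorem coeff_qInvMul_natCast_sub_one (F : ℤ⟦X⟧) (m : ℕ) :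
    (qInvMul F).coeff (m - 1) = coeff m F := by
  rw [qInvMul, HahnSeries.coeff_single_mul, one_mul, sub_neg_eq_add, sub_add_cancel,
    HahnSeries.ofPowerSeries_apply_coeff]

theorem coeff_qInvMul_of_lt (F : ℤ⟦X⟧) {n : ℤ} (hn : n < -1) : (qInvMul F).coeff n = 0 := by
  rw [qInvMul, HahnSeries.coeff_single_mul, one_mul, PowerSeries.coeff_coe, if_pos (by omega)]

/-- `q j_3 = (q)_∞^12 / (q^3)_∞^12` modulo `2`. -/
def haupt : (ZMod 2)⟦X⟧ := eta 1 ^ 12 * (eta 3 ^ 12)⁻¹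

theorem constantCoeff_eta_pow {k : ℕ} (hk : 1 ≤ k) (n : ℕ) : constantCoeff (eta k ^ n) = 1 := by
  rw [map_pow, constantCoeff_qTprod hk hk, one_pow]

theorem haupt_mul : haupt * eta 3 ^ 12 = eta 1 ^ 12 := by
  have := mul_inv_eq_one (constantCoeff_eta_pow (k := 3) (by norm_num) 12)
  rw [haupt]
  linear_combination eta 1 ^ 12 * this

theorem constantCoeff_qInf_pow {k : ℕ} (hk : 1 ≤ k) (n : ℕ) : constantCoeff (qInf k ^ n) = 1 := by
  rw [map_pow, constantCoeff_qInf hk, one_pow]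

theorem c3_natCast_sub_one (m : ℕ) : ((c3 (m - 1) : ℤ) : ZMod 2) = coeff m haupt := by
  rw [c3, j3, coeff_qInvMul_natCast_sub_one, ← coeff_red,
    red_frac _ (constantCoeff_qInf_pow (by norm_num) _), map_pow, map_pow, red_qInf le_rfl,
    red_qInf (by norm_num), haupt]

/-- The quotient reduces to E_1^3/E_3^9, which is H + q by `eta_one_mul_eta_three_pow_three`. The
extra `X` is the constant term of j_6. -/
theorem c6_natCast_sub_one (m : ℕ) : ((c6 (m - 1) : ℤ) : ZMod 2) = coeff m (haupt + X) := by
  rw [c6, j6, coeff_qInvMul_natCast_sub_one, ← coeff_red, red_frac _ (by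
    rw [map_mul, constantCoeff_qInf_pow (by norm_num), constantCoeff_qInf_pow (by norm_num),
      mul_one])]
  congr 1
  symm
  simp only [map_mul, map_pow]
  rw [red_qInf le_rfl, red_qInf (by norm_num), red_qInf (by norm_num), red_qInf (by norm_num),
    eq_mul_inv_iff_mul_eq (by
      rw [map_mul, constantCoeff_eta_pow le_rfl, constantCoeff_eta_pow (by norm_num), mul_one]
      exact one_ne_zero)]
  have h2 := eta_sq (k := 1) le_rfl
  have h6 := eta_sq (k := 3) (by norm_num)
  norm_num only at h2 h6
  rw [← h2, ← h6]
  linear_combination eta 1 ^ 3 * eta 3 ^ 6 * haupt_mul -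
    eta 1 ^ 3 * eta 3 ^ 6 * eta_one_mul_eta_three_pow_three

theorem c12_natCast_sub_one (m : ℕ) : ((c12 (m - 1) : ℤ) : ZMod 2) = coeff m haupt := by
  rw [c12, j12, coeff_qInvMul_natCast_sub_one, ← coeff_red, red_frac _ (by
    rw [map_mul, constantCoeff_qInf_pow (by norm_num), constantCoeff_qInf_pow (by norm_num),
      mul_one])]
  congr 1
  symm
  simp only [map_mul, map_pow]
  rw [red_qInf (by norm_num), red_qInf (by norm_num), red_qInf (by norm_num),
    red_qInf (by norm_num), eq_mul_inv_iff_mul_eq (by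
      rw [map_mul, constantCoeff_eta_pow (by norm_num), constantCoeff_eta_pow (by norm_num),
        mul_one]
      exact one_ne_zero)]
  have h2 := eta_sq (k := 1) le_rfl
  have h6 := eta_sq (k := 3) (by norm_num)
  have h4 := eta_pow_four (k := 1) le_rfl
  have h12 := eta_pow_four (k := 3) (by norm_num)
  norm_num only at h2 h6 h4 h12
  rw [← h2, ← h6, ← h4, ← h12]
  linear_combination eta 1 ^ 4 * eta 3 ^ 4 * haupt_mul

/-! ### Dissections of the Hauptmodul -/

/-- H is the fourth power of E_1^3/E_3^3, and fourth powers are q → q^4. -/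
theorem haupt_eq_expand :
    haupt = expand 4 four_ne_zero (eta 1 ^ 3 * (eta 3 ^ 3)⁻¹) := by
  have h1 := mul_inv_eq_one (constantCoeff_eta_pow (k := 3) (by norm_num) 3)
  have h2 : eta 1 ^ 3 * (eta 3 ^ 3)⁻¹ * eta 3 ^ 3 = eta 1 ^ 3 := by
    linear_combination eta 1 ^ 3 * h1
  have h3 := congrArg (expand 4 four_ne_zero) h2
  rw [map_mul, map_pow, map_pow, expand_eta _ le_rfl, expand_eta _ (by norm_num),
    ← eta_pow_four le_rfl, ← eta_pow_four (by norm_num), ← pow_mul, ← pow_mul] at h3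
  refine mul_right_cancel₀ (pow_ne_zero 12 (eta_ne_zero (k := 3) (by norm_num))) ?_
  rw [haupt_mul]
  exact h3.symm

/-- Divide E_1^3 = E_3 + q E_9^3 by E_3^3: the first term is 1/E_6, that is f_3(q^6), and the second
is q λ_6(q^3), because λ_6 E_1^3 = θE_1 = E_3^3. -/
theorem eta_quotient_eq_expand : eta 1 ^ 3 * (eta 3 ^ 3)⁻¹ =
    expand 3 three_ne_zero (expand 2 two_ne_zero (red f3)) +
      X * expand 3 three_ne_zero (red lambda6) := by
  symm
  rw [eq_mul_inv_iff_mul_eq (by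
    rw [constantCoeff_eta_pow (by norm_num)]; exact one_ne_zero), eta_one_pow_three]
  have h1 := congrArg (fun a ↦ expand 3 three_ne_zero (expand 2 two_ne_zero a)) red_f3_mul_eta
  have h2 : red lambda6 * eta 1 ^ 3 = eta 3 ^ 3 := by
    have := theta_mul_eta (k := 1) le_rfl
    rw [mul_one] at this
    linear_combination eta 1 * red_lambda6 + this
  have h3 := congrArg (expand 3 three_ne_zero) h2
  simp only [map_mul, map_pow, map_one] at h1 h3
  rw [expand_eta _ le_rfl, expand_eta _ (by norm_num)] at h1 h3
  have h4 := eta_sq (k := 3) (by norm_num)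
  norm_num only at h1 h3 h4
  rw [← h4] at h1
  linear_combination eta 3 * h1 + X * h3

theorem expand_two_theta : expand 2 two_ne_zero (theta 1) = theta 1 ^ 2 := by
  have h := theta_mul_eta (k := 1) le_rfl
  have h1 := congrArg (expand 2 two_ne_zero) h
  rw [map_mul, map_pow, expand_eta _ le_rfl, expand_eta _ (by norm_num), ← eta_sq le_rfl,
    ← eta_sq (by norm_num)] at h1
  refine mul_right_cancel₀ (pow_ne_zero 2 (eta_ne_zero (k := 1) le_rfl)) (h1.trans ?_)
  linear_combination -(theta 1 * eta 1 + eta (3 * 1) ^ 3) * h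

/-- The `2`-dissection of the sixth order mock theta function `λ` modulo `2`. -/
theorem X_mul_red_lambda6 : X * red lambda6 =
    X * expand 2 two_ne_zero (eta 1 ^ 3) + expand 2 two_ne_zero (red psi6) := by
  refine mul_right_cancel₀ (pow_ne_zero 2 (eta_ne_zero (k := 1) le_rfl)) ?_
  have h1 := congrArg (expand 2 two_ne_zero) red_psi6
  rw [map_mul, map_mul, map_pow, expand_two_theta, expand_X, expand_eta _ le_rfl,
    ← eta_sq le_rfl] at h1
  -- After multiplication by E_1², the claim is q times θ = E_1^8 + qθ^4.
  have h2 := theta_one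
  rw [← theta_one_pow_four, show 8 = 4 * (2 * 1) by norm_num, ← eta_pow_four (by norm_num),
    ← eta_sq le_rfl] at h2
  rw [map_pow, expand_eta _ le_rfl, ← eta_sq le_rfl]
  linear_combination X * red_lambda6 - h1 + X * h2

theorem expand_two_red_f3 : expand 2 two_ne_zero (red f3) = red twoMu6 := by
  have h := congrArg (expand 2 two_ne_zero) red_f3_mul_eta
  rw [map_mul, map_one, expand_eta _ le_rfl, ← eta_sq le_rfl] at h
  exact mul_right_cancel₀ (pow_ne_zero 2 (eta_ne_zero (k := 1) le_rfl)) (h.trans red_twoMu6.symm)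

theorem coeff_haupt_of_not_dvd {m : ℕ} (h : ¬ 4 ∣ m) : coeff m haupt = 0 := by
  rw [haupt_eq_expand, coeff_expand_of_not_dvd _ _ _ h]

theorem coeff_haupt_twelve_mul (m : ℕ) :
    coeff (12 * m) haupt = coeff m (expand 2 two_ne_zero (red f3)) := by
  rw [haupt_eq_expand, show 12 * m = 4 * (3 * m) by ring, coeff_expand_mul,
    eta_quotient_eq_expand, map_add, coeff_expand_mul]
  rcases m with _ | m
  · simp
  · rw [show 3 * (m + 1) = (3 * m + 2) + 1 by ring, coeff_succ_X_mul,
      coeff_expand_of_not_dvd 3 _ (red lambda6) (by omega), add_zero]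

theorem coeff_haupt_twelve_mul_add_four (m : ℕ) :
    coeff (12 * m + 4) haupt = coeff m (red lambda6) := by
  rw [haupt_eq_expand, show 12 * m + 4 = 4 * (3 * m + 1) by ring, coeff_expand_mul,
    eta_quotient_eq_expand, map_add, coeff_succ_X_mul, coeff_expand_mul,
    coeff_expand_of_not_dvd _ _ _ (by omega), zero_add]

/-- Exponents 2 modulo 3 occur neither in f_3(q^6) nor in q λ_6(q^3). -/
theorem coeff_haupt_twelve_mul_add_eight (m : ℕ) : coeff (12 * m + 8) haupt = 0 := by
  rw [haupt_eq_expand, show 12 * m + 8 = 4 * (3 * m + 1 + 1) by ring, coeff_expand_mul,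
    eta_quotient_eq_expand, map_add, coeff_succ_X_mul,
    coeff_expand_of_not_dvd _ _ _ (by omega), coeff_expand_of_not_dvd _ _ _ (by omega), zero_add]

theorem coeff_red_lambda6_two_mul (n : ℕ) :
    coeff (2 * n) (red lambda6) = coeff n (eta 1 ^ 3) := by
  have h := congrArg (coeff (2 * n + 1)) X_mul_red_lambda6
  rwa [map_add, coeff_succ_X_mul, coeff_succ_X_mul, coeff_expand_mul,
    coeff_expand_of_not_dvd _ _ _ (by omega), add_zero] at h

theorem coeff_red_lambda6_two_mul_add_one (n : ℕ) :
    coeff (2 * n + 1) (red lambda6) = coeff (n + 1) (red psi6) := by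
  have h := congrArg (coeff (2 * n + 1 + 1)) X_mul_red_lambda6
  rwa [map_add, coeff_succ_X_mul, coeff_succ_X_mul, show 2 * n + 1 + 1 = 2 * (n + 1) by ring,
    coeff_expand_mul, coeff_expand_of_not_dvd _ _ _ (by omega), zero_add] at h

theorem constantCoeff_red_psi6 : constantCoeff (red psi6) = 0 := by
  have h := congrArg (constantCoeff (R := ZMod 2)) red_psi6
  rwa [map_mul, map_mul, constantCoeff_qTprod le_rfl le_rfl, constantCoeff_X, zero_mul,
    mul_one] at h

theorem coeff_eta_one_pow_three (n : ℕ) :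
    coeff n (eta 1 ^ 3) = 1 ↔ ∃ k : ℕ, n = k * (k + 1) / 2 := by
  have htri : ∀ k : ℕ, k * (k + 1) / 2 = (k + 1).choose 2 := fun k ↦ by
    rw [Nat.choose_two_right, Nat.add_sub_cancel, mul_comm]
  have hmono : StrictMono fun k : ℕ ↦ (k + 1).choose 2 :=
    strictMono_nat_of_lt_succ fun k ↦ by
      change (k + 1).choose 2 < (k + 1 + 1).choose 2
      rw [choose_two_succ (k + 1)]
      omega
  simp only [htri]
  rw [eta_pow_three le_rfl]
  simp only [one_mul]
  rw [coeff_tsum (summable_X_pow le_choose_two_succ)]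
  simp only [coeff_X_pow]
  constructor
  · intro h
    by_contra! hne
    simp [hne] at h
  · rintro ⟨k, rfl⟩
    -- Triangular numbers are distinct, so exactly one term contributes and nothing cancels modulo
    -- 2.
    rw [tsum_eq_single k fun j hj ↦ if_neg fun h ↦ hj (hmono.injective h).symm, if_pos rfl]

end HauptMock

end

theorem theorem1p2 :
    (∀ n : ℤ, 1 ≤ n → HauptMock.c3 n ≡ HauptMock.c6 n [ZMOD 2] ∧
      HauptMock.c6 n ≡ HauptMock.c12 n [ZMOD 2]) ∧
    (∀ n : ℕ, HauptMock.c3 (2 * n) ≡ 0 [ZMOD 2] ∧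
      HauptMock.c3 (4 * n + 1) ≡ 0 [ZMOD 2] ∧
      HauptMock.c3 (12 * n + 7) ≡ 0 [ZMOD 2] ∧
      HauptMock.c3 (24 * n + 11) ≡ 0 [ZMOD 2]) ∧
    (∀ n : ℕ,
      HauptMock.c3 (24 * n - 1) ≡ PowerSeries.coeff n HauptMock.f3 [ZMOD 2] ∧
      HauptMock.c3 (24 * n - 1) ≡ PowerSeries.coeff n HauptMock.phi3 [ZMOD 2] ∧
      HauptMock.c3 (24 * n - 1) ≡ PowerSeries.coeff n HauptMock.phi6 [ZMOD 2] ∧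
      HauptMock.c3 (24 * n - 1) ≡ PowerSeries.coeff (2 * n) HauptMock.twoMu6 [ZMOD 2] ∧
      HauptMock.c3 (24 * n - 1) ≡ (Fintype.card (Nat.Partition n) : ℤ) [ZMOD 2]) ∧
    (∀ n : ℕ, HauptMock.c3 (24 * n - 9) ≡ PowerSeries.coeff n HauptMock.psi6 [ZMOD 2]) ∧
    (∀ n : ℕ, HauptMock.c3 (24 * n + 3) ≡ 1 [ZMOD 2] ↔ ∃ k : ℕ, n = k * (k + 1) / 2) ∧
    (∀ n : ℕ, HauptMock.c3 (12 * n + 3) ≡ PowerSeries.coeff n HauptMock.lambda6 [ZMOD 2]) := by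
  open HauptMock in
  have hmod : ∀ a b : ℤ, a ≡ b [ZMOD 2] ↔ (a : ZMod 2) = b := fun a b ↦
    (ZMod.intCast_eq_intCast_iff a b 2).symm
  have hc3 : ∀ (n : ℤ) (m : ℕ), n = m - 1 → ((c3 n : ℤ) : ZMod 2) = PowerSeries.coeff m haupt :=
    fun n m h ↦ h ▸ c3_natCast_sub_one m
  refine ⟨fun n hn ↦ ?_, fun n ↦ ⟨?_, ?_, ?_, ?_⟩, fun n ↦ ?_, fun n ↦ ?_, fun n ↦ ?_, fun n ↦ ?_⟩
  · obtain ⟨m, rfl⟩ : ∃ m : ℕ, n = (m : ℤ) - 1 := ⟨(n + 1).toNat, by omega⟩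
    -- The discrepancy `X` sits at m = 1, that is n = 0, which 1 ≤ n excludes.
    have hX : PowerSeries.coeff m (PowerSeries.X : PowerSeries (ZMod 2)) = 0 := by
      rw [PowerSeries.coeff_X, if_neg (by omega)]
    rw [hmod, hmod, c3_natCast_sub_one, c6_natCast_sub_one, c12_natCast_sub_one, map_add, hX,
      add_zero]
    exact ⟨rfl, rfl⟩
  · rw [hmod, hc3 _ (2 * n + 1) (by push_cast; ring), coeff_haupt_of_not_dvd (by omega),
      Int.cast_zero]
  · rw [hmod, hc3 _ (4 * n + 2) (by push_cast; ring), coeff_haupt_of_not_dvd (by omega),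
      Int.cast_zero]
  · rw [hmod, hc3 _ (12 * n + 8) (by push_cast; ring), coeff_haupt_twelve_mul_add_eight,
      Int.cast_zero]
  -- The index is an odd multiple of 12, and f_3(q²) has no odd exponents.
  · rw [hmod, hc3 _ (12 * (2 * n + 1)) (by push_cast; ring), coeff_haupt_twelve_mul,
      PowerSeries.coeff_expand_of_not_dvd _ _ _ (by omega), Int.cast_zero]
  · have hp : red f3 = PowerSeries.mk fun n ↦ (Fintype.card (Nat.Partition n) : ZMod 2) :=
      mul_right_cancel₀ (eta_ne_zero le_rfl) (red_f3_mul_eta.trans mk_card_partition_mul_eta.symm)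
    have h : ((c3 (24 * n - 1) : ℤ) : ZMod 2) = PowerSeries.coeff n (red f3) := by
      rw [hc3 _ (12 * (2 * n)) (by push_cast; ring), coeff_haupt_twelve_mul,
        PowerSeries.coeff_expand_mul]
    simp only [hmod, h]
    refine ⟨coeff_red _ _, ?_, ?_, ?_, ?_⟩
    · rw [← red_phi3, coeff_red]
    · rw [← red_phi6, coeff_red]
    · rw [← coeff_red, ← expand_two_red_f3, PowerSeries.coeff_expand_mul]
    · rw [hp, PowerSeries.coeff_mk, Int.cast_natCast]
  · rw [hmod, ← coeff_red]
    rcases n with _ | n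
    -- At n = 0 the exponent -9 lies below the pole of j_3, and ψ_6 has no constant term modulo 2.
    · rw [PowerSeries.coeff_zero_eq_constantCoeff_apply, constantCoeff_red_psi6, c3, j3,
        coeff_qInvMul_of_lt _ (by norm_num), Int.cast_zero]
    · rw [hc3 _ (12 * (2 * n + 1) + 4) (by push_cast; ring), coeff_haupt_twelve_mul_add_four,
        coeff_red_lambda6_two_mul_add_one]
  · rw [hmod, hc3 _ (12 * (2 * n) + 4) (by push_cast; ring), coeff_haupt_twelve_mul_add_four,
      coeff_red_lambda6_two_mul, Int.cast_one, coeff_eta_one_pow_three]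
  · rw [hmod, hc3 _ (12 * n + 4) (by push_cast; ring), coeff_haupt_twelve_mul_add_four, coeff_red]
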